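/- **Lemma (colored Kauffman skein relation).** For $m,n\ge 0$ let $\mathcal S(m,n)$ be the relative Kauffman bracket skein module, over $\mathbb Q(A)$, of a rectangle with $m$ marked points on the top edge and $n$ on the bottom edge: the free $\mathbb Q(A)$-module on the isotopy classes of framed tangles (given by diagrams with blackboard framing), modulo the relation $D\sqcup\bigcirc=-(A^2+A^{-2})D$ and the Kauffman skein relation. For a crossing whose strand from the upper left to the lower right is the over-strand, the latter reads $$\text{crossing}=A\,\bigl(\text{a } \cup \text{ above a } \cap\bigr)+A^{-1}\,\bigl(\text{two vertical strands}\bigr),$$ and for the other crossing the two smoothings on the right are interchanged. Let $\Delta_k=(-1)^k\dfrac{A^{2(k+1)}-A^{-2(k+1)}}{A^2-A^{-2}}$, and let $f^{(k)}\in TL_k=\mathcal S(k,k)$ be the Jones–Wenzl idempotent: $f^{(0)}$ is the empty tangle, $f^{(1)}$ is one strand, and $$f^{(k+2)}=(f^{(k+1)}\otimes 1)-\frac{\Delta_k}{\Delta_{k+1}}\,(f^{(k+1)}\otimes 1)\,e_{k+1}\,(f^{(k+1)}\otimes 1),$$ where $e_{k+1}$ consists of $k$ vertical strands followed on the right by a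 $\cup$ above a $\cap$. Let $n\ge 0$. For a crossing of two strands let $X_{n+1}\in\mathcal S(2n+2,2n+2)$ be the skein element in which each strand is replaced by $n+1$ parallel strands and decorated, at its upper end, with one $f^{(n+1)}$. Let $H_{n+1}$ be the following skein element. There is an $f^{(n+1)}$ at each of the four corners. The innermost strands of the two upper idempotents are joined by a $\cup$, those of the two lower idempotents are joined by a $\cap$, and in between the remaining two bundles of $n$ parallel strands cross, in the same sense as the original crossing. Let $V_{n+1}$ be the following skein element. There is an $f^{(n+1)}$ at each of the four corners. The outermost strand of the upper left (upper right) idempotent is joined by a vertical strand to the outermost strand of the lower left (lower right) one, and in between the remaining two bundles of $n$ parallel strands cross, in the same sense as the original crossing. If the strand from the upper left to the lower right is the over-strand, then $$X_{n+1}=A^{2n+1}H_{n+1}+A^{-(2n+1)}V_{n+1},$$ and for the other crossing $$X_{n+1}=A^{2n+1}V_{n+1}+A^{-(2n+1)}H_{n+1}.$$ Both identities also hold if $X_{n+1}$ is replaced by the crossing of the two bundles with an $f^{(n+1)}$ at each of its four corners. For $n=0$, $X_1$ is the crossing, $H_1$ is a $\cup$ above a $\cap$, and $V_1$ is two vertical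 strands, so that the identities are the Kauffman skein relation. -/

import Mathlib

/-!
Kauffman bracket skein modules of the rectangular disk, the Jones-Wenzl idempotents, and the
colored crossing with its two colored smoothings.

Tangle diagrams in the rectangle are put in general position with respect to the height, and are
read from top to bottom as words in elementary pieces. Framings are blackboard framings.
-/

namespace KauffmanSkein

noncomputable section

/-- The elementary pieces of a tangle diagram.
`cup` is `∪` (two strands coming from above are joined), `cap` is `∩` (two strands going down are
created), `cross true` is the crossing whose strand from the upper left to the lower right is the
over-strand, and `cross false` is the crossing where that strand is the under-strand. -/
inductive Kind : Type
  | cup : Kind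
  | cap : Kind
  | cross : Bool → Kind

/-- The number of strands of a piece at its top. -/
def Kind.inputs : Kind → ℕ
  | .cup => 2
  | .cap => 0
  | .cross _ => 2

/-- The number of strands of a piece at its bottom. -/
def Kind.outputs : Kind → ℕ
  | .cup => 0
  | .cap => 2
  | .cross _ => 2

/-- An elementary piece together with the number of vertical strands on its left. -/
structure Piece : Type where
  kind : Kind
  left : ℕ

/-- `∪` with `i` vertical strands on its left. -/
abbrev cup (i : ℕ) : Piece := ⟨.cup, i⟩

/-- `∩` with `i` vertical strands on its left. -/
abbrev cap (i : ℕ) : Piece := ⟨.cap, i⟩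

/-- A crossing with `i` vertical strands on its left. -/
abbrev cross (s : Bool) (i : ℕ) : Piece := ⟨.cross s, i⟩

/-- `Connects w m n`: the word `w` (read from top to bottom) is a tangle diagram with `m` points
on the top edge and `n` points on the bottom edge. In the recursive clause `k` is the number of
vertical strands on the right of the first piece. -/
def Connects : List Piece → ℕ → ℕ → Prop
  | [], m, n => m = n
  | p :: w, m, n =>
      ∃ k, m = p.left + p.kind.inputs + k ∧ Connects w (p.left + p.kind.outputs + k) n

/-- Tangle diagrams in the rectangle with `m` points on the top edge and `n` on the bottom. -/
def Diagram (m n : ℕ) : Type := {w : List Piece // Connects w m n}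

/-- The local moves that generate isotopy of framed tangles: planar isotopy, the second and third
Reidemeister moves, and the framed version of the first one. -/
inductive LocalMove : List Piece → List Piece → Prop
  /-- pieces that lie side by side can exchange their heights -/
  | exchange (p q : Kind) (i k : ℕ) :
      LocalMove [⟨p, i⟩, ⟨q, i + p.outputs + k⟩] [⟨q, i + p.inputs + k⟩, ⟨p, i⟩]
  /-- a zigzag can be straightened -/
  | zigzag_left (i : ℕ) : LocalMove [cap i, cup (i + 1)] []
  | zigzag_right (i : ℕ) : LocalMove [cap (i + 1), cup i] []
  /-- a strand can be moved over or under a local maximum or minimum -/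
  | slide_cap (s : Bool) (i : ℕ) :
      LocalMove [cap i, cross s (i + 1)] [cap (i + 1), cross (!s) i]
  | slide_cup (s : Bool) (i : ℕ) :
      LocalMove [cross s i, cup (i + 1)] [cross (!s) (i + 1), cup i]
  /-- two kinks of the same writhe, on the two sides of a strand -/
  | reidemeister_one (s : Bool) (i : ℕ) :
      LocalMove [cap (i + 1), cross s i, cup (i + 1)] [cap i, cross s (i + 1), cup i]
  | reidemeister_two (s : Bool) (i : ℕ) : LocalMove [cross s i, cross (!s) i] []
  | reidemeister_three (s : Bool) (i : ℕ) :
      LocalMove [cross s i, cross s (i + 1), cross s i]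
        [cross s (i + 1), cross s i, cross s (i + 1)]

/-- Two diagrams differ by one local move, performed somewhere inside the diagram. -/
def Move {m n : ℕ} (d e : Diagram m n) : Prop :=
  ∃ u v l r : List Piece, LocalMove l r ∧ d.1 = u ++ l ++ v ∧ e.1 = u ++ r ++ v

/-- Isotopy classes of framed tangles with `m` points on top and `n` points on the bottom:
diagrams up to the equivalence relation that the moves generate. -/
def Tangle (m n : ℕ) : Type := Quot (@Move m n)

/-- The isotopy class of a diagram. -/
def Diagram.toTangle {m n : ℕ} (d : Diagram m n) : Tangle m n := Quot.mk _ d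

/-- The field `ℚ(A)`. -/
abbrev QA : Type := RatFunc ℚ

/-- The indeterminate `A`. -/
def A : QA := RatFunc.X

/-- The tangle of `d`, as an element of the free `ℚ(A)`-module on the isotopy classes. -/
def free {m n : ℕ} (d : Diagram m n) : Tangle m n →₀ QA := Finsupp.single d.toTangle 1

/-- The Kauffman relations. In `crossing_true` and `crossing_false`, the diagrams `d`, `h`, `v`
agree except at one place, where `d` has a crossing, `h` has `∪` above `∩`, and `v` has two
vertical strands; the first term is the smoothing that joins the two regions which the over-strand
sweeps out when it is turned counterclockwise. In `circle`, `d` is `e` with an additional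
trivial circle. -/
inductive KauffmanRel {m n : ℕ} : (Tangle m n →₀ QA) → Prop
  | crossing_true (a b : List Piece) (i : ℕ) (d h v : Diagram m n)
      (hd : d.1 = a ++ [cross true i] ++ b) (hh : h.1 = a ++ [cup i, cap i] ++ b)
      (hv : v.1 = a ++ b) :
      KauffmanRel (free d - A • free h - A⁻¹ • free v)
  | crossing_false (a b : List Piece) (i : ℕ) (d h v : Diagram m n)
      (hd : d.1 = a ++ [cross false i] ++ b) (hh : h.1 = a ++ [cup i, cap i] ++ b)
      (hv : v.1 = a ++ b) :
      KauffmanRel (free d - A • free v - A⁻¹ • free h)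
  | circle (a b : List Piece) (i : ℕ) (d e : Diagram m n)
      (hd : d.1 = a ++ [cap i, cup i] ++ b) (he : e.1 = a ++ b) :
      KauffmanRel (free d + (A ^ 2 + A⁻¹ ^ 2) • free e)

/-- The relative Kauffman bracket skein module of the rectangle with `m` points on the top edge
and `n` points on the bottom edge. The Temperley-Lieb algebra `TL_n` is `Skein n n`. -/
def Skein (m n : ℕ) : Type :=
  (Tangle m n →₀ QA) ⧸ Submodule.span QA {x : Tangle m n →₀ QA | KauffmanRel x}

instance (m n : ℕ) : AddCommGroup (Skein m n) :=
  inferInstanceAs (AddCommGroup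
    ((Tangle m n →₀ QA) ⧸ Submodule.span QA {x : Tangle m n →₀ QA | KauffmanRel x}))

instance (m n : ℕ) : Module QA (Skein m n) :=
  inferInstanceAs (Module QA
    ((Tangle m n →₀ QA) ⧸ Submodule.span QA {x : Tangle m n →₀ QA | KauffmanRel x}))

/-- The quotient map from the free module to the skein module. -/
def proj (m n : ℕ) : (Tangle m n →₀ QA) →ₗ[QA] Skein m n :=
  Submodule.mkQ (Submodule.span QA {x : Tangle m n →₀ QA | KauffmanRel x})

/-- The class of a diagram in the skein module. -/
def Diagram.toSkein {m n : ℕ} (d : Diagram m n) : Skein m n := proj m n (free d)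

/-! ### Linear maps out of the skein module -/

/-- A function on diagrams that is invariant under the moves and satisfies the Kauffman
relations. -/
structure Respects {m n : ℕ} {M : Type} [AddCommGroup M] [Module QA M]
    (φ : Diagram m n → M) : Prop where
  move : ∀ d e : Diagram m n, Move d e → φ d = φ e
  crossing_true : ∀ (a b : List Piece) (i : ℕ) (d h v : Diagram m n),
    d.1 = a ++ [cross true i] ++ b → h.1 = a ++ [cup i, cap i] ++ b → v.1 = a ++ b →
    φ d = A • φ h + A⁻¹ • φ v
  crossing_false : ∀ (a b : List Piece) (i : ℕ) (d h v : Diagram m n),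
    d.1 = a ++ [cross false i] ++ b → h.1 = a ++ [cup i, cap i] ++ b → v.1 = a ++ b →
    φ d = A • φ v + A⁻¹ • φ h
  circle : ∀ (a b : List Piece) (i : ℕ) (d e : Diagram m n),
    d.1 = a ++ [cap i, cup i] ++ b → e.1 = a ++ b → φ d = -((A ^ 2 + A⁻¹ ^ 2) • φ e)

/-- The extension of a function on diagrams to the free module on isotopy classes. -/
def liftFree {m n : ℕ} {M : Type} [AddCommGroup M] [Module QA M]
    (φ : Diagram m n → M) (hφ : Respects φ) : (Tangle m n →₀ QA) →ₗ[QA] M :=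
  Finsupp.linearCombination QA (Quot.lift φ hφ.move)

theorem liftFree_free {m n : ℕ} {M : Type} [AddCommGroup M] [Module QA M]
    (φ : Diagram m n → M) (hφ : Respects φ) (d : Diagram m n) :
    liftFree φ hφ (free d) = φ d := by
  refine (Finsupp.linearCombination_single QA (1 : QA) d.toTangle).trans ?_
  exact one_smul QA (φ d)

/-- The linear map on the skein module that a function on diagrams induces. -/
def lift {m n : ℕ} {M : Type} [AddCommGroup M] [Module QA M]
    (φ : Diagram m n → M) (hφ : Respects φ) : Skein m n →ₗ[QA] M :=
  Submodule.liftQ _ (liftFree φ hφ) (by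
    rw [Submodule.span_le]
    rintro x hx
    rw [SetLike.mem_coe, LinearMap.mem_ker]
    cases hx with
    | crossing_true a b i d h v hd hh hv =>
      simp only [map_sub, map_smul, liftFree_free]
      rw [hφ.crossing_true a b i d h v hd hh hv]; abel
    | crossing_false a b i d h v hd hh hv =>
      simp only [map_sub, map_smul, liftFree_free]
      rw [hφ.crossing_false a b i d h v hd hh hv]; abel
    | circle a b i d e hd he =>
      simp only [map_add, map_smul, liftFree_free]
      rw [hφ.circle a b i d e hd he]; abel)

theorem lift_toSkein {m n : ℕ} {M : Type} [AddCommGroup M] [Module QA M]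
    (φ : Diagram m n → M) (hφ : Respects φ) (d : Diagram m n) :
    lift φ hφ d.toSkein = φ d :=
  liftFree_free φ hφ d

/-- Linear maps out of the skein module agree if they agree on diagrams. -/
theorem skein_hom_ext {m n : ℕ} {M : Type} [AddCommGroup M] [Module QA M]
    {f g : Skein m n →ₗ[QA] M} (h : ∀ d : Diagram m n, f d.toSkein = g d.toSkein) : f = g := by
  apply Submodule.linearMap_qext
  apply Finsupp.lhom_ext'
  intro t
  induction t using Quot.ind with
  | _ d =>
    apply LinearMap.ext_ring
    exact h d

/-- The Kauffman relations and the moves hold in the skein module. -/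
theorem respects_toSkein (m n : ℕ) : Respects (fun d : Diagram m n => d.toSkein) where
  move d e h := by
    have : d.toTangle = e.toTangle := Quot.sound h
    simp only [Diagram.toSkein, free, this]
  crossing_true a b i d h v hd hh hv := by
    have h0 : proj m n (free d - A • free h - A⁻¹ • free v) = 0 :=
      (Submodule.Quotient.mk_eq_zero _).2
        (Submodule.subset_span (KauffmanRel.crossing_true a b i d h v hd hh hv))
    rw [map_sub, map_sub, map_smul, map_smul, sub_sub, sub_eq_zero] at h0
    exact h0
  crossing_false a b i d h v hd hh hv := by
    have h0 : proj m n (free d - A • free v - A⁻¹ • free h) = 0 :=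
      (Submodule.Quotient.mk_eq_zero _).2
        (Submodule.subset_span (KauffmanRel.crossing_false a b i d h v hd hh hv))
    rw [map_sub, map_sub, map_smul, map_smul, sub_sub, sub_eq_zero] at h0
    exact h0
  circle a b i d e hd he := by
    have h0 : proj m n (free d + (A ^ 2 + A⁻¹ ^ 2) • free e) = 0 :=
      (Submodule.Quotient.mk_eq_zero _).2
        (Submodule.subset_span (KauffmanRel.circle a b i d e hd he))
    rw [map_add, map_smul, add_eq_zero_iff_eq_neg] at h0
    exact h0

/-! ### Vertical concatenation and juxtaposition -/

theorem connects_append {u v : List Piece} {l m n : ℕ} (hu : Connects u l m)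
    (hv : Connects v m n) : Connects (u ++ v) l n := by
  induction u generalizing l with
  | nil => cases hu; exact hv
  | cons p u ih =>
    obtain ⟨k, hk, h⟩ := hu
    exact ⟨k, hk, ih h⟩

theorem connects_padRight {w : List Piece} {m n : ℕ} (t : ℕ) (h : Connects w m n) :
    Connects w (m + t) (n + t) := by
  induction w generalizing m with
  | nil => cases h; rfl
  | cons p w ih =>
    obtain ⟨k, hk, h⟩ := h
    refine ⟨k + t, by omega, ?_⟩
    have := ih h
    rwa [Nat.add_assoc] at this

/-- A piece with `t` more vertical strands on its left. -/
def Piece.shift (t : ℕ) (p : Piece) : Piece := ⟨p.kind, t + p.left⟩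

theorem connects_padLeft {w : List Piece} {m n : ℕ} (t : ℕ) (h : Connects w m n) :
    Connects (w.map (Piece.shift t)) (t + m) (t + n) := by
  induction w generalizing m with
  | nil => cases h; rfl
  | cons p w ih =>
    obtain ⟨k, hk, h⟩ := h
    refine ⟨k, by simp only [Piece.shift]; omega, ?_⟩
    have := ih h
    simp only [Piece.shift]
    rwa [show t + p.left + p.kind.outputs + k = t + (p.left + p.kind.outputs + k) by omega]

/-- `m` vertical strands. -/
def Diagram.id (m : ℕ) : Diagram m m := ⟨[], rfl⟩

/-- Vertical concatenation: `d` on top of `e`. -/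
def Diagram.comp {l m n : ℕ} (d : Diagram l m) (e : Diagram m n) : Diagram l n :=
  ⟨d.1 ++ e.1, connects_append d.2 e.2⟩

/-- `d` with `t` vertical strands on its right. -/
def Diagram.padRight {m n : ℕ} (t : ℕ) (d : Diagram m n) : Diagram (m + t) (n + t) :=
  ⟨d.1, connects_padRight t d.2⟩

/-- `d` with `t` vertical strands on its left. -/
def Diagram.padLeft {m n : ℕ} (t : ℕ) (d : Diagram m n) : Diagram (t + m) (t + n) :=
  ⟨d.1.map (Piece.shift t), connects_padLeft t d.2⟩

theorem LocalMove.shift {l r : List Piece} (t : ℕ) (h : LocalMove l r) :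
    LocalMove (l.map (Piece.shift t)) (r.map (Piece.shift t)) := by
  cases h with
  | exchange p q i k =>
    have := LocalMove.exchange p q (t + i) k
    simpa only [List.map, Piece.shift, Nat.add_assoc] using this
  | zigzag_left i => exact .zigzag_left (t + i)
  | zigzag_right i => exact .zigzag_right (t + i)
  | slide_cap s i => exact .slide_cap s (t + i)
  | slide_cup s i => exact .slide_cup s (t + i)
  | reidemeister_one s i => exact .reidemeister_one s (t + i)
  | reidemeister_two s i => exact .reidemeister_two s (t + i)
  | reidemeister_three s i => exact .reidemeister_three s (t + i)

theorem respects_comp_right {l m n : ℕ} (d : Diagram l m) :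
    Respects (fun e : Diagram m n => (d.comp e).toSkein) where
  move e e' h := by
    obtain ⟨u, v, x, y, hxy, h1, h2⟩ := h
    exact (respects_toSkein l n).move _ _
      ⟨d.1 ++ u, v, x, y, hxy, by simp [Diagram.comp, h1], by simp [Diagram.comp, h2]⟩
  crossing_true a b i e h v he hh hv :=
    (respects_toSkein l n).crossing_true (d.1 ++ a) b i _ _ _
      (by simp [Diagram.comp, he]) (by simp [Diagram.comp, hh]) (by simp [Diagram.comp, hv])
  crossing_false a b i e h v he hh hv :=
    (respects_toSkein l n).crossing_false (d.1 ++ a) b i _ _ _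
      (by simp [Diagram.comp, he]) (by simp [Diagram.comp, hh]) (by simp [Diagram.comp, hv])
  circle a b i e e' he he' :=
    (respects_toSkein l n).circle (d.1 ++ a) b i _ _
      (by simp [Diagram.comp, he]) (by simp [Diagram.comp, he'])

theorem respects_comp_left {l m n : ℕ} (e : Diagram m n) :
    Respects (fun d : Diagram l m => (d.comp e).toSkein) where
  move d d' h := by
    obtain ⟨u, v, x, y, hxy, h1, h2⟩ := h
    exact (respects_toSkein l n).move _ _
      ⟨u, v ++ e.1, x, y, hxy, by simp [Diagram.comp, h1], by simp [Diagram.comp, h2]⟩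
  crossing_true a b i d h v hd hh hv :=
    (respects_toSkein l n).crossing_true a (b ++ e.1) i _ _ _
      (by simp [Diagram.comp, hd]) (by simp [Diagram.comp, hh]) (by simp [Diagram.comp, hv])
  crossing_false a b i d h v hd hh hv :=
    (respects_toSkein l n).crossing_false a (b ++ e.1) i _ _ _
      (by simp [Diagram.comp, hd]) (by simp [Diagram.comp, hh]) (by simp [Diagram.comp, hv])
  circle a b i d d' hd hd' :=
    (respects_toSkein l n).circle a (b ++ e.1) i _ _
      (by simp [Diagram.comp, hd]) (by simp [Diagram.comp, hd'])

theorem respects_compMap (l m n : ℕ) :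
    Respects (fun d : Diagram l m =>
      lift (fun e : Diagram m n => (d.comp e).toSkein) (respects_comp_right d)) where
  move d d' h := skein_hom_ext fun e => by
    simp only [lift_toSkein]
    exact (respects_comp_left e).move d d' h
  crossing_true a b i d h v hd hh hv := skein_hom_ext fun e => by
    simp only [lift_toSkein, LinearMap.add_apply, LinearMap.smul_apply]
    exact (respects_comp_left e).crossing_true a b i d h v hd hh hv
  crossing_false a b i d h v hd hh hv := skein_hom_ext fun e => by
    simp only [lift_toSkein, LinearMap.add_apply, LinearMap.smul_apply]
    exact (respects_comp_left e).crossing_false a b i d h v hd hh hv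
  circle a b i d d' hd hd' := skein_hom_ext fun e => by
    simp only [lift_toSkein, LinearMap.neg_apply, LinearMap.smul_apply]
    exact (respects_comp_left e).circle a b i d d' hd hd'

/-- Vertical concatenation of skein elements, extended bilinearly from diagrams. -/
def compMap (l m n : ℕ) : Skein l m →ₗ[QA] Skein m n →ₗ[QA] Skein l n :=
  lift (fun d : Diagram l m =>
    lift (fun e : Diagram m n => (d.comp e).toSkein) (respects_comp_right d))
    (respects_compMap l m n)

/-- `x` on top of `y`. -/
def Skein.comp {l m n : ℕ} (x : Skein l m) (y : Skein m n) : Skein l n := compMap l m n x y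

infixl:75 " ⊙ " => Skein.comp

theorem toSkein_comp {l m n : ℕ} (d : Diagram l m) (e : Diagram m n) :
    d.toSkein ⊙ e.toSkein = (d.comp e).toSkein := by
  simp only [Skein.comp, compMap, lift_toSkein]

theorem respects_padRight (m n t : ℕ) :
    Respects (fun d : Diagram m n => (d.padRight t).toSkein) where
  move d e h := by
    obtain ⟨u, v, x, y, hxy, h1, h2⟩ := h
    exact (respects_toSkein _ _).move _ _ ⟨u, v, x, y, hxy, h1, h2⟩
  crossing_true a b i d h v hd hh hv :=
    (respects_toSkein _ _).crossing_true a b i (d.padRight t) (h.padRight t) (v.padRight t)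
      hd hh hv
  crossing_false a b i d h v hd hh hv :=
    (respects_toSkein _ _).crossing_false a b i (d.padRight t) (h.padRight t) (v.padRight t)
      hd hh hv
  circle a b i d e hd he :=
    (respects_toSkein _ _).circle a b i (d.padRight t) (e.padRight t) hd he

theorem respects_padLeft (m n t : ℕ) :
    Respects (fun d : Diagram m n => (d.padLeft t).toSkein) where
  move d e h := by
    obtain ⟨u, v, x, y, hxy, h1, h2⟩ := h
    exact (respects_toSkein _ _).move _ _
      ⟨u.map (Piece.shift t), v.map (Piece.shift t), _, _, hxy.shift t,
        by simp [Diagram.padLeft, h1], by simp [Diagram.padLeft, h2]⟩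
  crossing_true a b i d h v hd hh hv :=
    (respects_toSkein _ _).crossing_true (a.map (Piece.shift t)) (b.map (Piece.shift t)) (t + i)
      (d.padLeft t) (h.padLeft t) (v.padLeft t)
      (by simp [Diagram.padLeft, hd, Piece.shift]) (by simp [Diagram.padLeft, hh, Piece.shift])
      (by simp [Diagram.padLeft, hv])
  crossing_false a b i d h v hd hh hv :=
    (respects_toSkein _ _).crossing_false (a.map (Piece.shift t)) (b.map (Piece.shift t)) (t + i)
      (d.padLeft t) (h.padLeft t) (v.padLeft t)
      (by simp [Diagram.padLeft, hd, Piece.shift]) (by simp [Diagram.padLeft, hh, Piece.shift])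
      (by simp [Diagram.padLeft, hv])
  circle a b i d e hd he :=
    (respects_toSkein _ _).circle (a.map (Piece.shift t)) (b.map (Piece.shift t)) (t + i)
      (d.padLeft t) (e.padLeft t)
      (by simp [Diagram.padLeft, hd, Piece.shift]) (by simp [Diagram.padLeft, he])

/-- A skein element with `t` vertical strands added on its right. -/
def padRight {m n : ℕ} (t : ℕ) : Skein m n →ₗ[QA] Skein (m + t) (n + t) :=
  lift (fun d : Diagram m n => (d.padRight t).toSkein) (respects_padRight m n t)

/-- A skein element with `t` vertical strands added on its left. -/
def padLeft {m n : ℕ} (t : ℕ) : Skein m n →ₗ[QA] Skein (t + m) (t + n) :=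
  lift (fun d : Diagram m n => (d.padLeft t).toSkein) (respects_padLeft m n t)

/-- `x` on the left of `y`. -/
def juxtapose {m n m' n' : ℕ} (x : Skein m n) (y : Skein m' n') : Skein (m + m') (n + n') :=
  padRight m' x ⊙ padLeft n y

/-! ### The Jones-Wenzl idempotents -/

/-- `Δ_n = (-1)^n (A^(2(n+1)) - A^(-2(n+1))) / (A^2 - A^(-2))`. -/
def Delta (n : ℕ) : QA :=
  (-1) ^ n * (A ^ (2 * (n + 1)) - A⁻¹ ^ (2 * (n + 1))) / (A ^ 2 - A⁻¹ ^ 2)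

/-- `n` vertical strands, and to their right `∪` above `∩`. -/
def hook (n : ℕ) : Diagram (n + 2) (n + 2) :=
  ⟨[cup n, cap n], 0, rfl, 0, rfl, rfl⟩

/-- The Jones-Wenzl idempotent `f^(n)` of `TL_n`, by Wenzl's recursion. -/
def jonesWenzl : (n : ℕ) → Skein n n
  | 0 => (Diagram.id 0).toSkein
  | 1 => (Diagram.id 1).toSkein
  | n + 2 =>
      padRight 1 (jonesWenzl (n + 1)) -
        (Delta n / Delta (n + 1)) •
          (padRight 1 (jonesWenzl (n + 1)) ⊙ (hook n).toSkein ⊙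
            padRight 1 (jonesWenzl (n + 1)))

/-! ### Colored crossings and colored smoothings -/

/-- The diagram that consists of a single crossing. -/
def simpleCrossing (s : Bool) : Diagram 2 2 := ⟨[cross s 0], 0, rfl, rfl⟩

/-- Two bundles of `n` parallel strands crossing each other: the strands of the left bundle, from
the rightmost one to the leftmost one, pass one after the other through the `n` strands of the
right bundle. For `s = true` the bundle from the upper left to the lower right is on top. -/
def crossWord (s : Bool) (n : ℕ) : List Piece :=
  (List.range n).reverse.flatMap fun k => (List.range n).map fun j => cross s (k + j)

theorem connects_of_cross {w : List Piece} {N : ℕ}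
    (h : ∀ p ∈ w, ∃ s i, p = cross s i ∧ i + 2 ≤ N) : Connects w N N := by
  induction w with
  | nil => rfl
  | cons p w ih =>
    obtain ⟨s, i, rfl, hi⟩ := h p (by simp)
    refine ⟨N - (i + 2), by simp [Kind.inputs]; omega, ?_⟩
    have := ih fun q hq => h q (by simp [hq])
    rwa [show (cross s i).left + (cross s i).kind.outputs + (N - (i + 2)) = N by
      simp [Kind.outputs]; omega]

theorem connects_crossWord (s : Bool) (n : ℕ) : Connects (crossWord s n) (n + n) (n + n) := by
  apply connects_of_cross
  intro p hp
  simp only [crossWord, List.mem_flatMap, List.mem_reverse, List.mem_range, List.mem_map] at hp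
  obtain ⟨k, hk, j, hj, rfl⟩ := hp
  exact ⟨s, k + j, rfl, by omega⟩

/-- The crossing of two bundles of `n` parallel strands. -/
def bundleCrossing (s : Bool) (n : ℕ) : Diagram (n + n) (n + n) :=
  ⟨crossWord s n, connects_crossWord s n⟩

/-- The underlying diagram of the horizontal smoothing: the innermost strands of the two bundles
of `n + 1` strands are joined by `∪` at the top and by `∩` at the bottom, and in between the
remaining bundles of `n` strands cross. -/
def horizontalDiagram (s : Bool) (n : ℕ) : Diagram (n + 1 + (n + 1)) (n + 1 + (n + 1)) :=
  ⟨[cup n] ++ (crossWord s n ++ [cap n]),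
    n, by simp only [Kind.inputs]; omega,
    connects_append (u := crossWord s n) (v := [cap n]) (m := n + n) (connects_crossWord s n)
      ⟨n, rfl, show n + 2 + n = n + 1 + (n + 1) by omega⟩⟩

/-- The underlying diagram of the vertical smoothing: the outermost strands of the two bundles
of `n + 1` strands run vertically, on the left and on the right, and in between the remaining
bundles of `n` strands cross. -/
def verticalDiagram (s : Bool) (n : ℕ) : Diagram (n + 1 + (n + 1)) (n + 1 + (n + 1)) :=
  ⟨(crossWord s n).map (Piece.shift 1), by
    have h := connects_padRight 1 (connects_padLeft 1 (connects_crossWord s n))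
    rwa [show 1 + (n + n) + 1 = n + 1 + (n + 1) by omega] at h⟩

/-- Two Jones-Wenzl idempotents side by side. -/
def boxes (n : ℕ) : Skein (n + n) (n + n) := juxtapose (jonesWenzl n) (jonesWenzl n)

/-- A diagram with a Jones-Wenzl idempotent at each of its four corners. -/
def withFourBoxes {n : ℕ} (d : Diagram (n + n) (n + n)) : Skein (n + n) (n + n) :=
  boxes n ⊙ d.toSkein ⊙ boxes n

/-- The crossing of two strands, each of which is decorated with `f^(n)` (once, at its upper
end). -/
def coloredCrossing (s : Bool) (n : ℕ) : Skein (n + n) (n + n) :=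
  boxes n ⊙ (bundleCrossing s n).toSkein

/-- The horizontal colored smoothing of the crossing of two strands of color `n + 1`. -/
def horizontalSmoothing (s : Bool) (n : ℕ) : Skein (n + 1 + (n + 1)) (n + 1 + (n + 1)) :=
  withFourBoxes (horizontalDiagram s n)

/-- The vertical colored smoothing of the crossing of two strands of color `n + 1`. -/
def verticalSmoothing (s : Bool) (n : ℕ) : Skein (n + 1 + (n + 1)) (n + 1 + (n + 1)) :=
  withFourBoxes (verticalDiagram s n)

end

end KauffmanSkein

open KauffmanSkein

namespace KauffmanSkein

noncomputable section

/-! ### The quantum integers -/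

/-! Two facts about Jones–Wenzl idempotents suffice: they are idempotent, and they annihilate every
`∪` or `∩` that returns to the same idempotent. Hence, between four idempotents on `2n + 2` strands,
a diagram that begins with a `∪` or ends with a `∩` at a position other than the middle one `n` is
zero (`sandwich_cup`, `sandwich_cap`).

Let `c` be the coefficient of `∪` above `∩` in the skein relation, so `c = A` or `c = A⁻¹`; this
treats both crossings at once. Resolve the crossing of the innermost strands, the topmost of the `(n
+ 1)²` crossings.

In the vertical term, `n` crossings of the rest of the first strand, and then the first crossing of
each of the `n` remaining strands, come to lie directly below an upper idempotent. Their `∪`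
smoothing dies, so each is replaced by two vertical strands at the cost of `c⁻¹`
(`sandwich_row_top`, `sandwich_rows_top`). What remains is the vertical smoothing.

In the horizontal term, the new `∩` is carried past `n` crossings to the right, and then back to the
middle past one crossing of each remaining strand. At each of these `2n` crossings one smoothing is
a zigzag, with factor `c`; in the other the `∩` drops to the bottom away from the middle and dies
(`sandwich_cap_row`, `sandwich_cap_rows`). What remains is the horizontal smoothing. The
coefficients are therefore `c ^ (2n + 1)` and `c⁻¹ ^ (2n + 1)`.

One idempotent per strand is as good as four at the corners, because idempotents slide through the
crossing of bundles (`boxes_mul_crossWord`). -/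

theorem A_ne_zero : A ≠ 0 := RatFunc.X_ne_zero

theorem A_pow_ne_one {k : ℕ} (hk : k ≠ 0) : A ^ k ≠ 1 := by
  intro h
  have h1 : algebraMap (Polynomial ℚ) QA (Polynomial.X ^ k) = algebraMap (Polynomial ℚ) QA 1 := by
    rw [map_pow, map_one, RatFunc.algebraMap_X]; exact h
  have h2 := congrArg Polynomial.natDegree (RatFunc.algebraMap_injective ℚ h1)
  simp at h2
  exact hk h2

theorem A_pow_sub_inv_pow_ne_zero {k : ℕ} (hk : k ≠ 0) : A ^ k - A⁻¹ ^ k ≠ 0 := by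
  intro h
  apply A_pow_ne_one (k := k + k) (by omega)
  rw [sub_eq_zero] at h
  rw [pow_add]
  nth_rw 1 [h]
  rw [← mul_pow, inv_mul_cancel₀ A_ne_zero, one_pow]

/-- `A` is not a root of unity, so no denominator in Wenzl's recursion vanishes. -/
theorem Delta_ne_zero (n : ℕ) : Delta n ≠ 0 :=
  div_ne_zero (mul_ne_zero (pow_ne_zero _ (by norm_num))
    (A_pow_sub_inv_pow_ne_zero (by omega))) (A_pow_sub_inv_pow_ne_zero (by omega))

theorem Delta_zero : Delta 0 = 1 := by
  have h := A_pow_sub_inv_pow_ne_zero (k := 2) (by omega)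
  simp only [Delta, pow_zero, one_mul, zero_add, mul_one]
  exact div_self h

theorem Delta_one : Delta 1 = -(A ^ 2 + A⁻¹ ^ 2) := by
  have h := A_pow_sub_inv_pow_ne_zero (k := 2) (by omega)
  rw [Delta, div_eq_iff h]
  ring

theorem Delta_add_two (n : ℕ) : Delta (n + 2) = Delta 1 * Delta (n + 1) - Delta n := by
  have h := A_pow_sub_inv_pow_ne_zero (k := 2) (by omega)
  have hA : A * A⁻¹ = 1 := mul_inv_cancel₀ A_ne_zero
  rw [Delta_one]
  simp only [Delta]
  rw [← mul_div_assoc, ← sub_div, div_left_inj' h]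
  -- With `A⁻¹` as a free letter, only the two mixed terms of the product need `A² B² = 1`; they
  -- supply the coefficient of `hB`.
  generalize A⁻¹ = B at *
  have hB : A ^ 2 * B ^ 2 = 1 := by rw [← mul_pow, hA, one_pow]
  simp only [mul_add, pow_add, mul_one]
  linear_combination (-1) ^ n * (B ^ (2 * n) * B ^ 2 - A ^ (2 * n) * A ^ 2) * hB

/-! ### Jones-Wenzl idempotents in Temperley-Lieb algebras -/

section JonesWenzl

variable {R S : Type*} [Ring R] [Algebra QA R] [Ring S] [Algebra QA S]

/-- The Jones-Wenzl element on the first `n` strands, as a polynomial in the elements `e i`. -/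
def wenzl (e : ℕ → R) : ℕ → R
  | 0 => 1
  | 1 => 1
  | n + 2 => wenzl e (n + 1) -
      (Delta n / Delta (n + 1)) • (wenzl e (n + 1) * e n * wenzl e (n + 1))

theorem wenzl_add_two (e : ℕ → R) (n : ℕ) :
    wenzl e (n + 2) = wenzl e (n + 1) -
      (Delta n / Delta (n + 1)) • (wenzl e (n + 1) * e n * wenzl e (n + 1)) := rfl

/-- Serves to transport the idempotents along the addition of strands on either side. -/
theorem map_wenzl (f : R →ₐ[QA] S) (e : ℕ → R) (e' : ℕ → S) (n : ℕ)
    (h : ∀ i, i + 2 ≤ n → f (e i) = e' i) : f (wenzl e n) = wenzl e' n := by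
  induction n with
  | zero => exact map_one f
  | succ n ih =>
    cases n with
    | zero => exact map_one f
    | succ n =>
      simp only [wenzl_add_two, map_sub, map_smul, map_mul, h n le_rfl,
        ih fun i hi => h i (by omega)]

/-- An element that intertwines the generators intertwines the Jones-Wenzl elements. -/
theorem wenzl_mul_eq_mul_wenzl (e e' : ℕ → R) (c : R) (n : ℕ)
    (h : ∀ i, i + 2 ≤ n → e i * c = c * e' i) : wenzl e n * c = c * wenzl e' n := by
  induction n with
  | zero => simp [wenzl]
  | succ n ih =>
    cases n with
    | zero => simp [wenzl]
    | succ n =>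
      have ih := ih fun i hi => h i (by omega)
      rw [wenzl_add_two, wenzl_add_two, sub_mul, mul_sub, smul_mul_assoc, mul_smul_comm, ih,
        mul_assoc, ih, mul_assoc, ← mul_assoc (e n), h n le_rfl, ← mul_assoc, ← mul_assoc, ih]
      simp only [mul_assoc]

/-- The Temperley-Lieb relations on `N` strands. -/
structure TemperleyLieb (e : ℕ → R) (N : ℕ) : Prop where
  sq : ∀ i, i + 2 ≤ N → e i * e i = Delta 1 • e i
  triple : ∀ i, i + 3 ≤ N → e (i + 1) * e i * e (i + 1) = e (i + 1)
  comm : ∀ i j, i + 2 ≤ j → j + 2 ≤ N → e i * e j = e j * e i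

variable {e : ℕ → R} {N : ℕ}

/-- Generators are numbered from `0`, so `wenzl e n` involves only `e i` with `i ≤ n - 2`, all far
from `e j`. -/
theorem TemperleyLieb.wenzl_comm (h : TemperleyLieb e N) {n j : ℕ} (hn : n ≤ j) (hj : j + 2 ≤ N) :
    wenzl e n * e j = e j * wenzl e n :=
  wenzl_mul_eq_mul_wenzl e e _ n fun i _ => h.comm i j (by omega) hj

theorem wenzl_mul_wenzl_succ {n : ℕ} (h : wenzl e n * wenzl e n = wenzl e n) :
    wenzl e n * wenzl e (n + 1) = wenzl e (n + 1) := by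
  cases n with
  | zero => simp [wenzl]
  | succ n => rw [wenzl_add_two, mul_sub, mul_smul_comm, ← mul_assoc, ← mul_assoc, h]

theorem wenzl_succ_mul_wenzl {n : ℕ} (h : wenzl e n * wenzl e n = wenzl e n) :
    wenzl e (n + 1) * wenzl e n = wenzl e (n + 1) := by
  cases n with
  | zero => simp [wenzl]
  | succ n => rw [wenzl_add_two, sub_mul, smul_mul_assoc, mul_assoc, h]

/-- The four properties need each other in a single induction: the last one, a form of the partial
trace, makes the two terms of Wenzl's recursion cancel when multiplied by `e n`; this annihilation
gives idempotency, and the recurrence for `Delta` gives the next partial trace. -/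
theorem TemperleyLieb.wenzl_properties (h : TemperleyLieb e N) (n : ℕ) (hn : n + 1 ≤ N) :
    wenzl e n * wenzl e n = wenzl e n ∧
    wenzl e (n + 1) * wenzl e (n + 1) = wenzl e (n + 1) ∧
    (∀ i, i + 2 ≤ n + 1 → e i * wenzl e (n + 1) = 0 ∧ wenzl e (n + 1) * e i = 0) ∧
    (n + 2 ≤ N → e n * wenzl e (n + 1) * e n =
      (Delta (n + 1) / Delta n) • (wenzl e n * e n)) := by
  induction n with
  | zero =>
    refine ⟨by simp [wenzl], by simp [wenzl], by omega, fun h2 => ?_⟩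
    simp [wenzl, Delta_zero, h.sq 0 h2]
  | succ n ih =>
    obtain ⟨i0, i1, i2, i3⟩ := ih (by omega)
    have i3 := i3 hn
    set f := wenzl e (n + 1) with hf
    have hg : wenzl e (n + 2) = f - (Delta n / Delta (n + 1)) • (f * e n * f) := rfl
    have hD : Delta n / Delta (n + 1) * (Delta (n + 1) / Delta n) = 1 := by
      have := Delta_ne_zero n; have := Delta_ne_zero (n + 1); field_simp
    have hl : e n * wenzl e (n + 2) = 0 := by
      rw [hg, mul_sub, mul_smul_comm, ← mul_assoc, ← mul_assoc, i3, smul_mul_assoc, smul_smul, hD,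
        one_smul, h.wenzl_comm le_rfl hn, mul_assoc, wenzl_mul_wenzl_succ i0, sub_self]
    have hr : wenzl e (n + 2) * e n = 0 := by
      rw [hg, sub_mul, smul_mul_assoc, mul_assoc, mul_assoc, ← mul_assoc (e n), i3, mul_smul_comm,
        smul_smul, hD, one_smul, ← mul_assoc, wenzl_succ_mul_wenzl i0, sub_self]
    have hgf : wenzl e (n + 2) * f = wenzl e (n + 2) := wenzl_succ_mul_wenzl i1
    refine ⟨i1, ?_, fun i hi => ?_, fun h2 => ?_⟩
    · nth_rw 2 [hg]
      rw [mul_sub, mul_smul_comm, ← mul_assoc, ← mul_assoc, hgf, hr, zero_mul, smul_zero, sub_zero]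
    · rcases (show i = n ∨ i + 2 ≤ n + 1 by omega) with rfl | hi
      · exact ⟨hl, hr⟩
      · obtain ⟨hi1, hi2⟩ := i2 i hi
        constructor
        · rw [hg, mul_sub, mul_smul_comm, ← mul_assoc, ← mul_assoc, hi1]; simp
        · rw [hg, sub_mul, smul_mul_assoc, mul_assoc, hi2]; simp
    · have hc : f * e (n + 1) = e (n + 1) * f := h.wenzl_comm le_rfl h2
      have hs := h.sq (n + 1) h2
      -- `f` does not touch the last strand, so both copies move outside and the triple relation
      -- applies.
      have ht : e (n + 1) * (f * e n * f) * e (n + 1) = f * e (n + 1) := by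
        calc e (n + 1) * (f * e n * f) * e (n + 1)
            = (e (n + 1) * f) * e n * (f * e (n + 1)) := by simp only [mul_assoc]
          _ = f * (e (n + 1) * e n * e (n + 1)) * f := by
            rw [← hc]; nth_rw 2 [hc]; simp only [mul_assoc]
          _ = f * e (n + 1) := by rw [h.triple n h2, mul_assoc, ← hc, ← mul_assoc, i1]
      rw [hg, mul_sub, sub_mul, mul_smul_comm, smul_mul_assoc, ht, ← hc, mul_assoc, hs,
        mul_smul_comm, ← sub_smul, Delta_add_two]
      congr 1
      have := Delta_ne_zero (n + 1); field_simp

theorem TemperleyLieb.wenzl_mul_self (h : TemperleyLieb e N) {n : ℕ} (hn : n ≤ N) :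
    wenzl e n * wenzl e n = wenzl e n := by
  cases n with
  | zero => simp [wenzl]
  | succ n => exact (h.wenzl_properties n hn).2.1

theorem TemperleyLieb.mul_wenzl (h : TemperleyLieb e N) {n i : ℕ} (hn : n ≤ N) (hi : i + 2 ≤ n) :
    e i * wenzl e n = 0 := by
  cases n with
  | zero => omega
  | succ n => exact ((h.wenzl_properties n hn).2.2.1 i hi).1

theorem TemperleyLieb.wenzl_mul (h : TemperleyLieb e N) {n i : ℕ} (hn : n ≤ N) (hi : i + 2 ≤ n) :
    wenzl e n * e i = 0 := by
  cases n with
  | zero => omega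
  | succ n => exact ((h.wenzl_properties n hn).2.2.1 i hi).2

end JonesWenzl

/-! ### The skein algebra -/

theorem skein_induction {m n : ℕ} {P : Skein m n → Prop} (hd : ∀ d : Diagram m n, P d.toSkein)
    (h0 : P 0) (ha : ∀ x y, P x → P y → P (x + y)) (hs : ∀ (c : QA) x, P x → P (c • x))
    (x : Skein m n) : P x := by
  -- The projection modulo this span vanishes on every diagram, hence is zero.
  have hspan : Submodule.span QA (Set.range (fun d : Diagram m n => d.toSkein)) = ⊤ := by
    rw [← Submodule.ker_mkQ (Submodule.span QA (Set.range fun d : Diagram m n => d.toSkein)),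
      LinearMap.ker_eq_top]
    apply Submodule.linearMap_qext
    apply Finsupp.lhom_ext'
    intro t
    induction t using Quot.ind with
    | _ d =>
      apply LinearMap.ext_ring
      exact (Submodule.Quotient.mk_eq_zero _).2 (Submodule.subset_span ⟨d, rfl⟩)
  have hx : x ∈ Submodule.span QA (Set.range fun d : Diagram m n => d.toSkein) := by
    rw [hspan]; trivial
  induction hx using Submodule.span_induction with
  | mem x h => obtain ⟨d, rfl⟩ := h; exact hd d
  | zero => exact h0
  | add x y _ _ hx hy => exact ha x y hx hy
  | smul c x _ hx => exact hs c x hx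

section Comp

variable {k l m n : ℕ}

theorem add_comp (x x' : Skein l m) (y : Skein m n) : (x + x') ⊙ y = x ⊙ y + x' ⊙ y := by
  simp [Skein.comp]

theorem comp_add (x : Skein l m) (y y' : Skein m n) : x ⊙ (y + y') = x ⊙ y + x ⊙ y' := by
  simp [Skein.comp]

theorem smul_comp (c : QA) (x : Skein l m) (y : Skein m n) : (c • x) ⊙ y = c • (x ⊙ y) := by
  simp [Skein.comp]

theorem comp_smul (c : QA) (x : Skein l m) (y : Skein m n) : x ⊙ (c • y) = c • (x ⊙ y) := by
  simp [Skein.comp]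

theorem zero_comp (y : Skein m n) : (0 : Skein l m) ⊙ y = 0 := by simp [Skein.comp]

theorem comp_zero (x : Skein l m) : x ⊙ (0 : Skein m n) = 0 := by simp [Skein.comp]

theorem comp_assoc (x : Skein k l) (y : Skein l m) (z : Skein m n) :
    x ⊙ y ⊙ z = x ⊙ (y ⊙ z) := by
  induction x using skein_induction with
  | h0 => simp only [zero_comp]
  | ha x x' hx hx' => simp only [add_comp, hx, hx']
  | hs c x hx => simp only [smul_comp, hx]
  | hd d =>
    induction y using skein_induction with
    | h0 => simp only [zero_comp, comp_zero]
    | ha x x' hx hx' => simp only [add_comp, comp_add, hx, hx']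
    | hs c x hx => simp only [smul_comp, comp_smul, hx]
    | hd e =>
      induction z using skein_induction with
      | h0 => simp only [comp_zero]
      | ha x x' hx hx' => simp only [comp_add, hx, hx']
      | hs c x hx => simp only [comp_smul, hx]
      | hd f =>
        simp only [toSkein_comp]
        congr 1
        exact Subtype.ext (List.append_assoc _ _ _)

theorem id_comp (x : Skein m n) : (Diagram.id m).toSkein ⊙ x = x := by
  induction x using skein_induction with
  | h0 => simp only [comp_zero]
  | ha x x' hx hx' => simp only [comp_add, hx, hx']
  | hs c x hx => simp only [comp_smul, hx]
  | hd d => exact toSkein_comp _ _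

theorem comp_id (x : Skein m n) : x ⊙ (Diagram.id n).toSkein = x := by
  induction x using skein_induction with
  | h0 => simp only [zero_comp]
  | ha x x' hx hx' => simp only [add_comp, hx, hx']
  | hs c x hx => simp only [smul_comp, hx]
  | hd d =>
    rw [toSkein_comp]
    congr 1
    exact Subtype.ext (List.append_nil _)

end Comp

local instance skeinMul (n : ℕ) : Mul (Skein n n) := ⟨Skein.comp⟩

local instance skeinOne (n : ℕ) : One (Skein n n) := ⟨(Diagram.id n).toSkein⟩

theorem mul_eq_comp {n : ℕ} (x y : Skein n n) : x * y = x ⊙ y := rfl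

/-- The skein module `Skein n n` is a ring under vertical concatenation. -/
local instance skeinRing (n : ℕ) : Ring (Skein n n) where
  left_distrib x y z := comp_add x y z
  right_distrib x y z := add_comp x y z
  zero_mul := zero_comp
  mul_zero := comp_zero
  mul_assoc := comp_assoc
  one_mul := id_comp
  mul_one := comp_id
  __ := (inferInstance : AddCommGroup (Skein n n))

local instance skeinAlgebra (n : ℕ) : Algebra QA (Skein n n) :=
  Algebra.ofModule (fun c x y => smul_comp c x y) (fun c x y => comp_smul c x y)

/-! ### Adding vertical strands is multiplicative. -/

theorem padRight_toSkein {m n : ℕ} (t : ℕ) (d : Diagram m n) :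
    padRight t d.toSkein = (d.padRight t).toSkein := lift_toSkein _ _ _

theorem padLeft_toSkein {m n : ℕ} (t : ℕ) (d : Diagram m n) :
    padLeft t d.toSkein = (d.padLeft t).toSkein := lift_toSkein _ _ _

theorem padRight_comp {l m n : ℕ} (t : ℕ) (x : Skein l m) (y : Skein m n) :
    padRight t (x ⊙ y) = padRight t x ⊙ padRight t y := by
  induction x using skein_induction with
  | h0 => simp only [zero_comp, map_zero]
  | ha x x' hx hx' => simp only [add_comp, map_add, hx, hx']
  | hs c x hx => simp only [smul_comp, map_smul, hx]
  | hd d =>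
    induction y using skein_induction with
    | h0 => simp only [comp_zero, map_zero]
    | ha x x' hx hx' => simp only [comp_add, map_add, hx, hx']
    | hs c x hx => simp only [comp_smul, map_smul, hx]
    | hd e => simp only [toSkein_comp, padRight_toSkein]; rfl

theorem padLeft_comp {l m n : ℕ} (t : ℕ) (x : Skein l m) (y : Skein m n) :
    padLeft t (x ⊙ y) = padLeft t x ⊙ padLeft t y := by
  induction x using skein_induction with
  | h0 => simp only [zero_comp, map_zero]
  | ha x x' hx hx' => simp only [add_comp, map_add, hx, hx']
  | hs c x hx => simp only [smul_comp, map_smul, hx]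
  | hd d =>
    induction y using skein_induction with
    | h0 => simp only [comp_zero, map_zero]
    | ha x x' hx hx' => simp only [comp_add, map_add, hx, hx']
    | hs c x hx => simp only [comp_smul, map_smul, hx]
    | hd e =>
      simp only [toSkein_comp, padLeft_toSkein]
      congr 1
      exact Subtype.ext List.map_append

/-- Adding strands on the right, as a homomorphism of algebras. -/
def padRightHom (n t : ℕ) : Skein n n →ₐ[QA] Skein (n + t) (n + t) :=
  AlgHom.ofLinearMap (padRight t) (padRight_toSkein t (Diagram.id n)) (padRight_comp t)

/-- Adding strands on the left, as a homomorphism of algebras. -/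
def padLeftHom (n t : ℕ) : Skein n n →ₐ[QA] Skein (t + n) (t + n) :=
  AlgHom.ofLinearMap (padLeft t) (padLeft_toSkein t (Diagram.id n)) (padLeft_comp t)

/-! ### Classes of words -/

/-- A word that is a diagram. -/
def Diagram.ofWord {m n : ℕ} (w : List Piece) (h : Connects w m n) : Diagram m n := ⟨w, h⟩

open Classical in
/-- The class of a word in the skein module; it is zero if the word is not a diagram. -/
def word (m n : ℕ) (w : List Piece) : Skein m n :=
  if h : Connects w m n then (Diagram.ofWord w h).toSkein else 0

theorem toSkein_eq_word {m n : ℕ} (d : Diagram m n) : d.toSkein = word m n d.1 := by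
  rw [word, dif_pos d.2]; rfl

theorem word_eq_toSkein {m n : ℕ} {w : List Piece} (h : Connects w m n) :
    word m n w = (Diagram.ofWord w h).toSkein := dif_pos h

theorem word_nil (n : ℕ) : word n n [] = 1 := word_eq_toSkein (w := []) rfl

theorem word_append {l m n : ℕ} {u v : List Piece} (hu : Connects u l m) (hv : Connects v m n) :
    word l n (u ++ v) = word l m u ⊙ word m n v := by
  rw [word_eq_toSkein hu, word_eq_toSkein hv, toSkein_comp,
    word_eq_toSkein (connects_append hu hv)]
  rfl

theorem padRight_word {m n : ℕ} {w : List Piece} (t : ℕ) (h : Connects w m n) :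
    padRight t (word m n w) = word (m + t) (n + t) w := by
  rw [word_eq_toSkein h, padRight_toSkein, toSkein_eq_word]; rfl

theorem padLeft_word {m n : ℕ} {w : List Piece} (t : ℕ) (h : Connects w m n) :
    padLeft t (word m n w) = word (t + m) (t + n) (w.map (Piece.shift t)) := by
  rw [word_eq_toSkein h, padLeft_toSkein, toSkein_eq_word]; rfl

/-- Eliminates the existential, so that being a diagram becomes linear arithmetic; the inequality
keeps the subtraction from truncating. -/
theorem connects_cons {p : Piece} {w : List Piece} {m n : ℕ} :
    Connects (p :: w) m n ↔ p.left + p.kind.inputs ≤ m ∧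
      Connects w (m - p.kind.inputs + p.kind.outputs) n := by
  constructor
  · rintro ⟨k, rfl, h⟩
    refine ⟨by omega, ?_⟩
    rwa [show p.left + p.kind.inputs + k - p.kind.inputs + p.kind.outputs =
      p.left + p.kind.outputs + k by omega]
  · rintro ⟨h, hw⟩
    refine ⟨m - (p.left + p.kind.inputs), by omega, ?_⟩
    rwa [show p.left + p.kind.outputs + (m - (p.left + p.kind.inputs)) =
      m - p.kind.inputs + p.kind.outputs by omega]

theorem connects_nil {m n : ℕ} : Connects [] m n ↔ m = n := Iff.rfl

theorem connects_of_append {u v : List Piece} {l n : ℕ} (h : Connects (u ++ v) l n) :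
    ∃ m, Connects u l m ∧ Connects v m n := by
  induction u generalizing l with
  | nil => exact ⟨l, rfl, h⟩
  | cons p u ih =>
    obtain ⟨k, hk, h⟩ := h
    obtain ⟨m, h1, h2⟩ := ih h
    exact ⟨m, ⟨k, hk, h1⟩, h2⟩

/-! ### Isotopies of words -/

/-- Wherever the word `u` is a diagram, so is `v`, and they have the same class. -/
def Isotopic (u v : List Piece) : Prop :=
  ∀ m n, Connects u m n → Connects v m n ∧ word m n u = word m n v

theorem Isotopic.refl (u : List Piece) : Isotopic u u := fun _ _ h => ⟨h, rfl⟩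

theorem Isotopic.trans {u v w : List Piece} (h : Isotopic u v) (h' : Isotopic v w) :
    Isotopic u w := fun m n hu =>
  ⟨(h' m n (h m n hu).1).1, (h m n hu).2.trans (h' m n (h m n hu).1).2⟩

theorem Isotopic.append {u u' v v' : List Piece} (hu : Isotopic u u') (hv : Isotopic v v') :
    Isotopic (u ++ v) (u' ++ v') := by
  intro l n h
  obtain ⟨m, h1, h2⟩ := connects_of_append h
  obtain ⟨h1', e1⟩ := hu _ _ h1
  obtain ⟨h2', e2⟩ := hv _ _ h2
  exact ⟨connects_append h1' h2', by rw [word_append h1 h2, word_append h1' h2', e1, e2]⟩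

theorem Isotopic.append_left (u : List Piece) {v v' : List Piece} (hv : Isotopic v v') :
    Isotopic (u ++ v) (u ++ v') := (Isotopic.refl u).append hv

theorem Isotopic.append_right {u u' : List Piece} (hu : Isotopic u u') (v : List Piece) :
    Isotopic (u ++ v) (u' ++ v) := hu.append (Isotopic.refl v)

instance : Trans Isotopic Isotopic Isotopic := ⟨Isotopic.trans⟩

theorem word_eq_of_localMove {l r : List Piece} (h : LocalMove l r) {m n : ℕ}
    (hl : Connects l m n) (hr : Connects r m n) : word m n l = word m n r := by
  rw [word_eq_toSkein hl, word_eq_toSkein hr]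
  exact (respects_toSkein m n).move _ _ ⟨[], [], l, r, h, by simp [Diagram.ofWord],
    by simp [Diagram.ofWord]⟩

theorem LocalMove.isotopic {l r : List Piece} (h : LocalMove l r) : Isotopic l r := by
  intro m n hl
  suffices hr : Connects r m n from ⟨hr, word_eq_of_localMove h hl hr⟩
  cases h <;> simp only [connects_cons, connects_nil, Kind.inputs, Kind.outputs] at * <;> omega

/-- `Isotopic` is not symmetric: the empty word is a diagram on too few strands for a zigzag to fit.
Reversed moves therefore need their own check. -/
theorem exchange_isotopic_symm (p q : Kind) (i k : ℕ) :
    Isotopic [⟨q, i + p.inputs + k⟩, ⟨p, i⟩] [⟨p, i⟩, ⟨q, i + p.outputs + k⟩] := by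
  intro m n hl
  suffices hr : Connects [⟨p, i⟩, ⟨q, i + p.outputs + k⟩] m n from
    ⟨hr, (word_eq_of_localMove (.exchange p q i k) hr hl).symm⟩
  simp only [connects_cons, connects_nil] at *
  omega

theorem slide_cap_isotopic_symm (s : Bool) (i : ℕ) :
    Isotopic [cap (i + 1), cross s i] [cap i, cross (!s) (i + 1)] := by
  intro m n hl
  suffices hr : Connects [cap i, cross (!s) (i + 1)] m n from
    ⟨hr, (word_eq_of_localMove (by simpa using LocalMove.slide_cap (!s) i) hr hl).symm⟩
  simp only [connects_cons, connects_nil, Kind.inputs, Kind.outputs] at *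
  omega

theorem cross_cross_isotopic (s t : Bool) {i j : ℕ} (h : i + 2 ≤ j ∨ j + 2 ≤ i) :
    Isotopic [cross s i, cross t j] [cross t j, cross s i] := by
  rcases h with h | h
  · obtain ⟨k, rfl⟩ := Nat.exists_eq_add_of_le h
    exact (LocalMove.exchange (.cross s) (.cross t) i k).isotopic
  · obtain ⟨k, rfl⟩ := Nat.exists_eq_add_of_le h
    exact exchange_isotopic_symm (.cross t) (.cross s) j k

/-- A crossing on the left of a local maximum can be moved above it. -/
theorem cap_cross_isotopic_left (s : Bool) {i j : ℕ} (h : j + 2 ≤ i) :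
    Isotopic [cap i, cross s j] [cross s j, cap i] := by
  obtain ⟨k, rfl⟩ := Nat.exists_eq_add_of_le h
  exact exchange_isotopic_symm (.cross s) .cap j k

/-- A crossing on the right of a local maximum can be moved above it. -/
theorem cap_cross_isotopic_right (s : Bool) {i j : ℕ} (h : i ≤ j) :
    Isotopic [cap i, cross s (j + 2)] [cross s j, cap i] := by
  obtain ⟨k, rfl⟩ := Nat.exists_eq_add_of_le h
  have := (LocalMove.exchange .cap (.cross s) i k).isotopic
  simpa [Kind.inputs, Kind.outputs, Nat.add_assoc, Nat.add_comm 2 k] using this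

/-- A strand can be pulled off a local maximum. -/
theorem cap_cross_cross_isotopic (s : Bool) (i : ℕ) :
    Isotopic [cap (i + 1), cross s i, cross s (i + 1)] [cap i] :=
  ((slide_cap_isotopic_symm s i).append_right [cross s (i + 1)]).trans
    (by simpa using ((LocalMove.reidemeister_two (!s) (i + 1)).isotopic.append_left [cap i]))

/-! ### Skein relations for words -/

/-- The coefficient of the smoothing `∪` above `∩` in the resolution of a crossing. -/
def smoothCoeff (s : Bool) : QA := if s then A else A⁻¹

theorem smoothCoeff_ne_zero (s : Bool) : smoothCoeff s ≠ 0 := by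
  cases s <;> simp [smoothCoeff, A_ne_zero]

theorem connects_smooth {m n : ℕ} {u v : List Piece} {s : Bool} {i : ℕ}
    (h : Connects (u ++ cross s i :: v) m n) :
    Connects (u ++ cup i :: cap i :: v) m n ∧ Connects (u ++ v) m n := by
  obtain ⟨k, hu, hv⟩ := connects_of_append h
  refine ⟨connects_append hu ?_, connects_append hu ?_⟩
  · simp only [connects_cons, Kind.inputs, Kind.outputs] at *
    rw [show k - 2 + 0 - 0 + 2 = k - 2 + 2 by omega]
    exact ⟨hv.1, by omega, hv.2⟩
  · simp only [connects_cons, Kind.inputs, Kind.outputs] at *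
    rw [show k = k - 2 + 2 by omega]
    exact hv.2

theorem word_cross {m n : ℕ} {u v : List Piece} {s : Bool} {i : ℕ}
    (h : Connects (u ++ cross s i :: v) m n) :
    word m n (u ++ cross s i :: v) = smoothCoeff s • word m n (u ++ cup i :: cap i :: v) +
      (smoothCoeff s)⁻¹ • word m n (u ++ v) := by
  obtain ⟨h1, h2⟩ := connects_smooth h
  rw [word_eq_toSkein h, word_eq_toSkein h1, word_eq_toSkein h2]
  cases s
  · rw [add_comm]
    simpa [smoothCoeff] using (respects_toSkein m n).crossing_false u v i (.ofWord _ h) (.ofWord _ h1)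
      (.ofWord _ h2)
      (by simp [Diagram.ofWord]) (by simp [Diagram.ofWord]) rfl
  · simpa [smoothCoeff] using (respects_toSkein m n).crossing_true u v i (.ofWord _ h) (.ofWord _ h1)
      (.ofWord _ h2)
      (by simp [Diagram.ofWord]) (by simp [Diagram.ofWord]) rfl

theorem word_circle {m n : ℕ} {u v : List Piece} {i : ℕ}
    (h : Connects (u ++ cap i :: cup i :: v) m n) :
    word m n (u ++ cap i :: cup i :: v) = Delta 1 • word m n (u ++ v) := by
  obtain ⟨k, hu, hv⟩ := connects_of_append h
  have h2 : Connects (u ++ v) m n := connects_append hu (by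
    simp only [connects_cons, Kind.inputs, Kind.outputs] at *
    rw [show k = k - 0 + 2 - 2 + 0 by omega]
    exact hv.2.2)
  rw [word_eq_toSkein h, word_eq_toSkein h2, Delta_one, neg_smul]
  exact (respects_toSkein m n).circle u v i (.ofWord _ h) (.ofWord _ h2)
    (by simp [Diagram.ofWord]) rfl

/-- The generator `e_i` of the Temperley-Lieb algebra. -/
def hookElement (N i : ℕ) : Skein N N := word N N [cup i, cap i]

theorem connects_hook {N i : ℕ} (h : i + 2 ≤ N) : Connects [cup i, cap i] N N := by
  simp only [connects_cons, connects_nil, Kind.inputs, Kind.outputs]; omega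

/-- Four exchanges of heights; the index of a right-hand piece drops by `2` while the left `∪` has
removed its two strands. -/
theorem hook_hook_isotopic {i j : ℕ} (h : i + 2 ≤ j) :
    Isotopic [cup i, cap i, cup j, cap j] [cup j, cap j, cup i, cap i] := by
  obtain ⟨k, rfl⟩ := Nat.exists_eq_add_of_le h
  have h1 : Isotopic [cap i, cup (i + 2 + k)] [cup (i + k), cap i] :=
    (LocalMove.exchange .cap .cup i k).isotopic
  have h2 : Isotopic [cup i, cup (i + k)] [cup (i + 2 + k), cup i] :=
    (LocalMove.exchange .cup .cup i k).isotopic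
  have h3 : Isotopic [cap i, cap (i + 2 + k)] [cap (i + k), cap i] :=
    (LocalMove.exchange .cap .cap i k).isotopic
  have h4 : Isotopic [cup i, cap (i + k)] [cap (i + 2 + k), cup i] :=
    (LocalMove.exchange .cup .cap i k).isotopic
  calc Isotopic [cup i, cap i, cup (i + 2 + k), cap (i + 2 + k)]
        [cup i, cup (i + k), cap i, cap (i + 2 + k)] :=
      (h1.append_right [cap (i + 2 + k)]).append_left [cup i]
    Isotopic _ [cup (i + 2 + k), cup i, cap i, cap (i + 2 + k)] := h2.append_right _
    Isotopic _ [cup (i + 2 + k), cup i, cap (i + k), cap i] := h3.append_left [_, _]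
    Isotopic _ [cup (i + 2 + k), cap (i + 2 + k), cup i, cap i] :=
      (h4.append_right [cap i]).append_left [_]

theorem temperleyLieb_hookElement (N : ℕ) : TemperleyLieb (hookElement N) N where
  sq i hi := by
    have h := connects_hook hi
    rw [mul_eq_comp, hookElement, ← word_append h h]
    exact word_circle (u := [cup i]) (v := [cap i]) (connects_append (u := [cup i, cap i]) h h)
  triple i hi := by
    have h := connects_hook (N := N) (i := i) (by omega)
    have h' := connects_hook hi
    rw [mul_eq_comp, mul_eq_comp, hookElement, hookElement, ← word_append h' h,
      ← word_append (connects_append h' h) h']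
    -- The three hooks contain two zigzags, one of each kind.
    have h1 : Isotopic [cup (i + 1), cap (i + 1), cup i, cap i, cup (i + 1), cap (i + 1)]
        [cup (i + 1), cap i, cup (i + 1), cap (i + 1)] :=
      ((LocalMove.zigzag_right i).isotopic.append_right _).append_left [_]
    have h2 : Isotopic [cup (i + 1), cap i, cup (i + 1), cap (i + 1)] [cup (i + 1), cap (i + 1)] :=
      ((LocalMove.zigzag_left i).isotopic.append_right _).append_left [_]
    exact ((h1.trans h2) N N (connects_append (connects_append h' h) h')).2
  comm i j hij hj := by
    have h := connects_hook (N := N) (i := i) (by omega)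
    have h' := connects_hook hj
    rw [mul_eq_comp, mul_eq_comp, hookElement, hookElement, ← word_append h h',
      ← word_append h' h]
    exact (hook_hook_isotopic hij N N (connects_append h h')).2

theorem padRight_hookElement {N i : ℕ} (t : ℕ) (h : i + 2 ≤ N) :
    padRight t (hookElement N i) = hookElement (N + t) i :=
  padRight_word t (connects_hook h)

theorem padLeft_hookElement {N i : ℕ} (t : ℕ) (h : i + 2 ≤ N) :
    padLeft t (hookElement N i) = hookElement (t + N) (t + i) :=
  padLeft_word t (connects_hook h)

theorem jonesWenzl_eq_wenzl (n : ℕ) : jonesWenzl n = wenzl (hookElement n) n := by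
  induction n with
  | zero => rfl
  | succ n ih =>
    cases n with
    | zero => rfl
    | succ n =>
      have h : padRight 1 (jonesWenzl (n + 1)) = wenzl (hookElement (n + 2)) (n + 1) := by
        rw [ih]
        exact map_wenzl (padRightHom (n + 1) 1) _ _ _ fun i hi => padRight_hookElement 1 hi
      rw [jonesWenzl, h, wenzl_add_two, toSkein_eq_word]
      rfl

theorem padRight_jonesWenzl (n t : ℕ) :
    padRight t (jonesWenzl n) = wenzl (hookElement (n + t)) n := by
  rw [jonesWenzl_eq_wenzl]
  exact map_wenzl (padRightHom n t) _ _ _ fun i hi => padRight_hookElement t hi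

theorem padLeft_jonesWenzl (n t : ℕ) :
    padLeft t (jonesWenzl n) = wenzl (fun i => hookElement (t + n) (t + i)) n := by
  rw [jonesWenzl_eq_wenzl]
  exact map_wenzl (padLeftHom n t) _ _ _ fun i hi => padLeft_hookElement t hi

/-! ### Bundles of crossings -/

/-- A strand passes from left to right through `m` strands. -/
def row (s : Bool) (c m : ℕ) : List Piece := (List.range m).map fun j => cross s (c + j)

/-- A bundle of `k` strands crosses a bundle of `m` strands, with `c` strands on the left. -/
def rows (s : Bool) (c : ℕ) : ℕ → ℕ → List Piece
  | 0, _ => []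
  | k + 1, m => row s (c + k) m ++ rows s c k m

theorem crossWord_eq_rows (s : Bool) (n : ℕ) : crossWord s n = rows s 0 n n := by
  suffices h : ∀ k, ((List.range k).reverse.flatMap fun i =>
      (List.range n).map fun j => cross s (i + j)) = rows s 0 k n from h n
  intro k
  induction k with
  | zero => rfl
  | succ k ih => rw [List.range_succ]; simp [ih, rows, row]

theorem map_shift_row (s : Bool) (t c m : ℕ) :
    (row s c m).map (Piece.shift t) = row s (t + c) m := by
  simp [row, Piece.shift, Nat.add_assoc]

theorem map_shift_rows (s : Bool) (t c k m : ℕ) :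
    (rows s c k m).map (Piece.shift t) = rows s (t + c) k m := by
  induction k with
  | zero => rfl
  | succ k ih => rw [rows, List.map_append, ih, map_shift_row, rows, Nat.add_assoc]

theorem row_zero (s : Bool) (c : ℕ) : row s c 0 = [] := rfl

theorem row_add (s : Bool) (c p q : ℕ) : row s c (p + q) = row s c p ++ row s (c + p) q := by
  simp [row, List.range_add, Nat.add_assoc, Function.comp_def]

theorem row_one (s : Bool) (c : ℕ) : row s c 1 = [cross s c] := rfl

theorem row_succ (s : Bool) (c m : ℕ) : row s c (m + 1) = row s c m ++ [cross s (c + m)] := by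
  rw [row_add, row_one]

theorem row_succ_left (s : Bool) (c m : ℕ) :
    row s c (m + 1) = cross s c :: row s (c + 1) m := by
  rw [Nat.add_comm, row_add, row_one]; rfl

theorem rows_succ (s : Bool) (c k m : ℕ) :
    rows s c (k + 1) m = row s (c + k) m ++ rows s c k m := rfl

/-- The recursion peels off the rightmost strand of the left bundle, at the top; this peels off the
leftmost one, at the bottom. -/
theorem rows_succ_bottom (s : Bool) (c k m : ℕ) :
    rows s c (k + 1) m = rows s (c + 1) k m ++ row s c m := by
  induction k with
  | zero => simp [rows]
  | succ k ih =>
    rw [rows_succ, ih, rows_succ, List.append_assoc, show c + 1 + k = c + (k + 1) by omega]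

theorem mem_row {s : Bool} {c m : ℕ} {q : Piece} (h : q ∈ row s c m) :
    ∃ j, j < m ∧ q = cross s (c + j) := by
  simp only [row, List.mem_map, List.mem_range] at h
  obtain ⟨j, hj, rfl⟩ := h
  exact ⟨j, hj, rfl⟩

theorem mem_rows {s : Bool} {c k m : ℕ} {q : Piece} (h : q ∈ rows s c k m) :
    ∃ j, j + 1 < k + m ∧ q = cross s (c + j) := by
  induction k with
  | zero => simp [rows] at h
  | succ k ih =>
    rw [rows, List.mem_append] at h
    rcases h with h | h
    · obtain ⟨j, hj, rfl⟩ := mem_row h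
      exact ⟨k + j, by omega, by rw [Nat.add_assoc]⟩
    · obtain ⟨j, hj, rfl⟩ := ih h
      exact ⟨j, by omega, rfl⟩

/-! ### Sliding crossings and local maxima through bundles. -/

theorem isotopic_cons_append {p : Piece} {w : List Piece}
    (h : ∀ q ∈ w, Isotopic [p, q] [q, p]) : Isotopic (p :: w) (w ++ [p]) := by
  induction w with
  | nil => exact .refl _
  | cons q w ih =>
    exact ((h q (by simp)).append_right w).trans
      ((ih fun r hr => h r (by simp [hr])).append_left [q])

theorem isotopic_append_cons {p : Piece} {w : List Piece}
    (h : ∀ q ∈ w, Isotopic [q, p] [p, q]) : Isotopic (w ++ [p]) (p :: w) := by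
  induction w with
  | nil => exact .refl _
  | cons q w ih =>
    exact ((ih fun r hr => h r (by simp [hr])).append_left [q]).trans
      ((h q (by simp)).append_right w)

theorem cross_row_comm (s : Bool) {i c m : ℕ} (h : i + 2 ≤ c ∨ c + m + 1 ≤ i) :
    Isotopic (cross s i :: row s c m) (row s c m ++ [cross s i]) :=
  isotopic_cons_append fun q hq => by
    obtain ⟨j, hj, rfl⟩ := mem_row hq
    exact cross_cross_isotopic s s (by omega)

theorem row_cross_comm (s : Bool) {i c m : ℕ} (h : i + 2 ≤ c ∨ c + m + 1 ≤ i) :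
    Isotopic (row s c m ++ [cross s i]) (cross s i :: row s c m) :=
  isotopic_append_cons fun q hq => by
    obtain ⟨j, hj, rfl⟩ := mem_row hq
    exact cross_cross_isotopic s s (by omega)

theorem cross_rows_comm (s : Bool) {i c k m : ℕ} (h : i + 2 ≤ c ∨ c + k + m ≤ i) :
    Isotopic (cross s i :: rows s c k m) (rows s c k m ++ [cross s i]) :=
  isotopic_cons_append fun q hq => by
    obtain ⟨j, hj, rfl⟩ := mem_rows hq
    exact cross_cross_isotopic s s (by omega)

theorem rows_cross_comm (s : Bool) {i c k m : ℕ} (h : i + 2 ≤ c ∨ c + k + m ≤ i) :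
    Isotopic (rows s c k m ++ [cross s i]) (cross s i :: rows s c k m) :=
  isotopic_append_cons fun q hq => by
    obtain ⟨j, hj, rfl⟩ := mem_rows hq
    exact cross_cross_isotopic s s (by omega)

theorem cap_row_comm (s : Bool) {i c m : ℕ} (h : c + m + 1 ≤ i) :
    Isotopic (cap i :: row s c m) (row s c m ++ [cap i]) :=
  isotopic_cons_append fun q hq => by
    obtain ⟨j, hj, rfl⟩ := mem_row hq
    exact cap_cross_isotopic_left s (by omega)

theorem cap_rows_comm (s : Bool) {i c k m : ℕ} (h : c + k + m ≤ i) :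
    Isotopic (cap i :: rows s c k m) (rows s c k m ++ [cap i]) :=
  isotopic_cons_append fun q hq => by
    obtain ⟨j, hj, rfl⟩ := mem_rows hq
    exact cap_cross_isotopic_left s (by omega)

theorem cap_row_right (s : Bool) {i c : ℕ} (m : ℕ) (h : i ≤ c) :
    Isotopic (cap i :: row s (c + 2) m) (row s c m ++ [cap i]) := by
  induction m generalizing c with
  | zero => exact .refl _
  | succ m ih =>
    rw [row_succ_left, row_succ_left, show c + 2 + 1 = c + 1 + 2 by omega]
    exact ((cap_cross_isotopic_right s h).append_right _).trans
      ((ih (c := c + 1) (by omega)).append_left [cross s c])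

/-- A strand that passes through both legs of a local maximum can be pulled off it. -/
theorem cap_row_across (s : Bool) (a p q : ℕ) :
    Isotopic (cap (a + p + 1) :: row s a (p + 2 + q)) (row s a (p + q) ++ [cap (a + p)]) := by
  have h1 := (cap_row_comm s (i := a + p + 1) (c := a) (m := p) (by omega)).append_right
    (cross s (a + p) :: cross s (a + p + 1) :: row s (a + p + 2) q)
  have h2 := ((cap_cross_cross_isotopic s (a + p)).append_left (row s a p)).append_right
    (row s (a + p + 2) q)
  have h3 := (cap_row_right s (i := a + p) q le_rfl).append_left (row s a p)
  have e : row s a (p + 2 + q) =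
      row s a p ++ cross s (a + p) :: cross s (a + p + 1) :: row s (a + p + 2) q := by
    rw [row_add, row_succ, row_succ]; simp [Nat.add_assoc]
  rw [e, row_add, List.append_assoc]
  refine Isotopic.trans ?_ h3
  simpa using h1.trans (by simpa using h2)

/-- Each of the `k` strands is pulled off the maximum in turn, which moves it one place to the left.
-/
theorem cap_rows_across (s : Bool) (k c p q : ℕ) :
    Isotopic (cap (c + p + k) :: rows s c k (p + 2 + q)) (rows s c k (p + q) ++ [cap (c + p)]) := by
  induction k with
  | zero => exact .refl _
  | succ k ih =>
    rw [rows_succ, rows_succ, List.append_assoc]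
    have h := (cap_row_across s (c + k) p q).append_right (rows s c k (p + 2 + q))
    rw [show c + k + p + 1 = c + p + (k + 1) by omega, show c + k + p = c + p + k by omega] at h
    exact h.trans (by simpa using ih.append_left (row s (c + k) (p + q)))

/-- One third Reidemeister move where the strand meets the crossing; the other `p + q` crossings are
far from it. -/
theorem cross_row_slide (s : Bool) (a p q : ℕ) :
    Isotopic (cross s (a + p + 1) :: row s a (p + 2 + q))
      (row s a (p + 2 + q) ++ [cross s (a + p)]) := by
  have e : row s a (p + 2 + q) =
      row s a p ++ cross s (a + p) :: cross s (a + p + 1) :: row s (a + p + 2) q := by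
    rw [row_add, row_succ, row_succ]; simp [Nat.add_assoc]
  rw [e]
  have h1 := (cross_row_comm s (i := a + p + 1) (c := a) (m := p) (by omega)).append_right
    (cross s (a + p) :: cross s (a + p + 1) :: row s (a + p + 2) q)
  have h2 := ((slide s (a + p)).append_left (row s a p)).append_right (row s (a + p + 2) q)
  have h3 := (cross_row_comm s (i := a + p) (c := a + p + 2) (m := q) (by omega)).append_left
    (row s a p ++ [cross s (a + p), cross s (a + p + 1)])
  simp only [List.append_assoc, List.cons_append, List.nil_append] at h1 h2 h3 ⊢
  exact (h1.trans h2).trans h3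
where
  slide (s : Bool) (i : ℕ) : Isotopic [cross s (i + 1), cross s i, cross s (i + 1)]
      [cross s i, cross s (i + 1), cross s i] := by
    intro m n hl
    suffices hr : Connects [cross s i, cross s (i + 1), cross s i] m n from
      ⟨hr, (word_eq_of_localMove (.reidemeister_three s i) hr hl).symm⟩
    simp only [connects_cons, connects_nil, Kind.inputs, Kind.outputs] at *
    omega

theorem cross_rows_slide_right (s : Bool) (k c p q : ℕ) :
    Isotopic (cross s (c + p + k) :: rows s c k (p + 2 + q))
      (rows s c k (p + 2 + q) ++ [cross s (c + p)]) := by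
  induction k with
  | zero => exact .refl _
  | succ k ih =>
    rw [rows_succ, List.append_assoc]
    have h := (cross_row_slide s (c + k) p q).append_right (rows s c k (p + 2 + q))
    rw [show c + k + p + 1 = c + p + (k + 1) by omega, show c + k + p = c + p + k by omega] at h
    exact h.trans (by simpa using ih.append_left (row s (c + k) (p + 2 + q)))

theorem cross_row_row_slide (s : Bool) (i m : ℕ) :
    Isotopic (cross s i :: (row s (i + 1) m ++ row s i m))
      (row s (i + 1) m ++ row s i m ++ [cross s (i + m)]) := by
  induction m with
  | zero => exact .refl _
  | succ m ih =>
    have h1 := ((row_cross_comm s (i := i + 1 + m) (c := i) (m := m) (by omega)).append_left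
      (row s (i + 1) m)).append_right [cross s (i + m), cross s (i + m + 1)]
    -- The last crossing of the upper row is moved below the first `m` of the lower row; after the
    -- third Reidemeister move `h1` moves it back.
    have h1' := ((cross_row_comm s (i := i + 1 + m) (c := i) (m := m) (by omega)).append_left
      (cross s i :: row s (i + 1) m)).append_right [cross s (i + m)]
    have h2 := ih.append_right [cross s (i + m + 1), cross s (i + m)]
    have h3 := ((LocalMove.reidemeister_three s (i + m)).isotopic).append_left
      (row s (i + 1) m ++ row s i m)
    rw [row_succ, row_succ]
    rw [show i + 1 + m = i + m + 1 by omega] at *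
    rw [show i + (m + 1) = i + m + 1 by omega]
    simp only [List.append_assoc, List.cons_append, List.nil_append] at h1 h1' h2 h3 ⊢
    exact h1'.trans (h2.trans (h3.trans h1))

/-- Only the rows of the two strands that cross each other interact with the crossing: the rows
above lie to its right, and those below to its left once it has moved by `m`. -/
theorem cross_rows_slide_left (s : Bool) (c i k m : ℕ) (h : i + 2 ≤ k) :
    Isotopic (cross s (c + i) :: rows s c k m) (rows s c k m ++ [cross s (c + i + m)]) := by
  induction k with
  | zero => omega
  | succ k ih =>
    rcases Nat.lt_or_ge (i + 1) k with hk | hk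
    · have h1 := (cross_row_comm s (i := c + i) (c := c + k) (m := m) (by omega)).append_right
        (rows s c k m)
      have h2 := (ih hk).append_left (row s (c + k) m)
      rw [rows_succ]
      simp only [List.append_assoc, List.cons_append, List.nil_append] at h1 h2 ⊢
      exact h1.trans h2
    · obtain rfl : k = i + 1 := by omega
      have h1 := (cross_row_row_slide s (c + i) m).append_right (rows s c i m)
      have h2 := (cross_rows_comm s (i := c + i + m) (c := c) (k := i) (m := m)
        (by omega)).append_left (row s (c + i + 1) m ++ row s (c + i) m)
      rw [rows_succ, rows_succ]
      simp only [List.append_assoc, List.cons_append, List.nil_append] at h1 h2 ⊢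
      exact h1.trans h2

/-! ### Idempotents on top of and below a crossing of bundles -/

theorem TemperleyLieb.shift {R : Type*} [Ring R] [Algebra QA R] {e : ℕ → R} {N : ℕ} (t : ℕ)
    (h : TemperleyLieb e (t + N)) : TemperleyLieb (fun i => e (t + i)) N where
  sq i hi := h.sq _ (by omega)
  triple i hi := h.triple (t + i) (by omega)
  comm i j hij hj := h.comm _ _ (by omega) (by omega)

theorem boxes_eq (n : ℕ) : boxes n =
    wenzl (hookElement (n + n)) n * wenzl (fun i => hookElement (n + n) (n + i)) n := by
  rw [boxes, juxtapose, padRight_jonesWenzl, padLeft_jonesWenzl]; rfl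

/-- The generators of the two factors act on disjoint strands. -/
theorem boxes_comm (n : ℕ) :
    wenzl (hookElement (n + n)) n * wenzl (fun i => hookElement (n + n) (n + i)) n =
    wenzl (fun i => hookElement (n + n) (n + i)) n * wenzl (hookElement (n + n)) n := by
  refine wenzl_mul_eq_mul_wenzl _ _ _ n fun i hi => ?_
  refine (wenzl_mul_eq_mul_wenzl _ _ _ n fun j hj => ?_).symm
  exact ((temperleyLieb_hookElement (n + n)).comm _ _ (by omega) (by omega)).symm

theorem boxes_mul_boxes (n : ℕ) : boxes n * boxes n = boxes n := by
  have h := temperleyLieb_hookElement (n + n)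
  have h1 := h.wenzl_mul_self (n := n) (by omega)
  have h2 := (h.shift n).wenzl_mul_self (n := n) le_rfl
  rw [boxes_eq]
  nth_rw 2 [boxes_comm]
  rw [mul_assoc, ← mul_assoc _ _ (wenzl (hookElement (n + n)) n), h2, ← boxes_comm, ← mul_assoc, h1]

/-- Only the hook at `n` touches both idempotents; any other is absorbed by one of them. -/
theorem boxes_mul_hookElement {n i : ℕ} (hi : i + 2 ≤ n + 1 + (n + 1)) (h : i ≠ n) :
    boxes (n + 1) * hookElement (n + 1 + (n + 1)) i = 0 := by
  have hT := temperleyLieb_hookElement (n + 1 + (n + 1))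
  rw [boxes_eq]
  rcases Nat.lt_or_gt_of_ne h with h | h
  · rw [boxes_comm, mul_assoc, hT.wenzl_mul (by omega) (by omega), mul_zero]
  · obtain ⟨j, rfl⟩ := Nat.exists_eq_add_of_lt h
    rw [mul_assoc, show n + j + 1 = n + 1 + j by omega,
      (hT.shift (n + 1)).wenzl_mul (n := n + 1) (i := j) le_rfl (by omega), mul_zero]

theorem hookElement_mul_boxes {n i : ℕ} (hi : i + 2 ≤ n + 1 + (n + 1)) (h : i ≠ n) :
    hookElement (n + 1 + (n + 1)) i * boxes (n + 1) = 0 := by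
  have hT := temperleyLieb_hookElement (n + 1 + (n + 1))
  rw [boxes_eq]
  rcases Nat.lt_or_gt_of_ne h with h | h
  · rw [← mul_assoc, hT.mul_wenzl (by omega) (by omega), zero_mul]
  · obtain ⟨j, rfl⟩ := Nat.exists_eq_add_of_lt h
    rw [boxes_comm, ← mul_assoc, show n + j + 1 = n + 1 + j by omega,
      (hT.shift (n + 1)).mul_wenzl (n := n + 1) (i := j) le_rfl (by omega), zero_mul]

theorem word_single_cross {N i : ℕ} (s : Bool) (h : i + 2 ≤ N) :
    word N N [cross s i] = smoothCoeff s • hookElement N i + (smoothCoeff s)⁻¹ • 1 := by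
  rw [← word_nil N]
  exact word_cross (u := []) (v := []) (by
    simp only [connects_cons, connects_nil, Kind.inputs, Kind.outputs, List.nil_append]; omega)

/-- If a crossing can be moved through `w`, so can the corresponding hook. -/
theorem hookElement_mul_word {N i j : ℕ} {s : Bool} {w : List Piece} (hw : Connects w N N)
    (hi : i + 2 ≤ N) (hj : j + 2 ≤ N) (h : Isotopic (cross s i :: w) (w ++ [cross s j])) :
    hookElement N i * word N N w = word N N w * hookElement N j := by
  have hc : ∀ {l}, l + 2 ≤ N → Connects [cross s l] N N := fun hl => by
    simp only [connects_cons, connects_nil, Kind.inputs, Kind.outputs]; omega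
  have e : word N N [cross s i] * word N N w = word N N w * word N N [cross s j] := by
    rw [mul_eq_comp, mul_eq_comp, ← word_append (hc hi) hw, ← word_append hw (hc hj)]
    exact (h N N (connects_append (hc hi) hw)).2
  -- A crossing is a nonzero multiple of a hook plus a multiple of the identity, and the identity
  -- terms cancel.
  rw [word_single_cross s hi, word_single_cross s hj, add_mul, mul_add, smul_mul_assoc,
    smul_mul_assoc, mul_smul_comm, mul_smul_comm, one_mul, mul_one, add_left_inj] at e
  exact smul_right_injective _ (smoothCoeff_ne_zero s) e

/-- The crossing carries the upper left idempotent to the lower right and the upper right one to the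
lower left; the two have the same color. -/
theorem boxes_mul_crossWord (s : Bool) (n : ℕ) :
    boxes n * word (n + n) (n + n) (crossWord s n) =
      word (n + n) (n + n) (crossWord s n) * boxes n := by
  have hC := connects_crossWord s n
  rw [crossWord_eq_rows] at *
  have h1 := wenzl_mul_eq_mul_wenzl (hookElement (n + n)) (fun i => hookElement (n + n) (n + i))
    (word (n + n) (n + n) (rows s 0 n n)) n fun i hi =>
      hookElement_mul_word (s := s) hC (by omega) (by omega) (by
        simpa [Nat.add_comm] using cross_rows_slide_left s 0 i n n hi)
  have h2 := wenzl_mul_eq_mul_wenzl (fun i => hookElement (n + n) (n + i)) (hookElement (n + n))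
    (word (n + n) (n + n) (rows s 0 n n)) n fun i hi =>
      hookElement_mul_word (s := s) hC (by omega) (by omega) (by
        obtain ⟨q, rfl⟩ := Nat.exists_eq_add_of_le hi
        have := cross_rows_slide_right s (i + 2 + q) 0 i q
        rwa [Nat.zero_add, Nat.add_comm i (i + 2 + q)] at this)
  rw [boxes_eq, mul_assoc, h2, ← mul_assoc, h1, mul_assoc, ← boxes_comm]

theorem coloredCrossing_eq_withFourBoxes (s : Bool) (n : ℕ) :
    coloredCrossing s n = withFourBoxes (bundleCrossing s n) := by
  have h := boxes_mul_crossWord s n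
  have h' : boxes n * (boxes n * word (n + n) (n + n) (crossWord s n)) =
      boxes n * word (n + n) (n + n) (crossWord s n) * boxes n := by rw [mul_assoc, ← h]
  rw [← mul_assoc, boxes_mul_boxes] at h'
  rw [coloredCrossing, withFourBoxes, toSkein_eq_word]
  exact h'

/-! ### Words between idempotents -/

/-- A word with a Jones-Wenzl idempotent at each of its four corners. -/
def sandwich (n : ℕ) (w : List Piece) : Skein (n + 1 + (n + 1)) (n + 1 + (n + 1)) :=
  boxes (n + 1) ⊙ word _ _ w ⊙ boxes (n + 1)

theorem withFourBoxes_eq_sandwich {n : ℕ} (d : Diagram (n + 1 + (n + 1)) (n + 1 + (n + 1))) :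
    withFourBoxes d = sandwich n d.1 := by
  rw [withFourBoxes, toSkein_eq_word, sandwich]

theorem Isotopic.sandwich_eq {n : ℕ} {u v : List Piece} (h : Isotopic u v)
    (hu : Connects u (n + 1 + (n + 1)) (n + 1 + (n + 1))) : sandwich n u = sandwich n v := by
  rw [sandwich, sandwich, (h _ _ hu).2]

/-- The idempotents annihilate hooks, and a `∪` differs from a hook above a `∪` by a circle, whose
value `Delta 1` is invertible. -/
theorem sandwich_cup {n i : ℕ} (h : i ≠ n) (w : List Piece) : sandwich n (cup i :: w) = 0 := by
  by_cases hw : Connects (cup i :: w) (n + 1 + (n + 1)) (n + 1 + (n + 1))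
  · have hi : i + 2 ≤ n + 1 + (n + 1) := (connects_cons.1 hw).1
    have hc := connects_append (connects_hook hi) hw
    have h1 := word_circle (u := [cup i]) (v := w) hc
    have h2 := word_append (connects_hook hi) hw
    have h3 : Delta 1 • sandwich n (cup i :: w) = 0 := by
      have e : Delta 1 • word (n + 1 + (n + 1)) (n + 1 + (n + 1)) (cup i :: w) =
          hookElement _ i ⊙ word _ _ (cup i :: w) := h1.symm.trans h2
      rw [sandwich, ← smul_comp, ← comp_smul, e, ← comp_assoc, ← mul_eq_comp (boxes (n + 1)),
        boxes_mul_hookElement hi h, zero_comp, zero_comp]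
    exact (smul_eq_zero.1 h3).resolve_left (Delta_ne_zero 1)
  -- A word that is not a diagram has class zero by convention.
  · rw [sandwich, word, dif_neg hw, comp_zero, zero_comp]

theorem sandwich_cap {n i : ℕ} (h : i ≠ n) (w : List Piece) : sandwich n (w ++ [cap i]) = 0 := by
  by_cases hw : Connects (w ++ [cap i]) (n + 1 + (n + 1)) (n + 1 + (n + 1))
  · have hi : i + 2 ≤ n + 1 + (n + 1) := by
      obtain ⟨m, -, hm⟩ := connects_of_append hw
      simp only [connects_cons, connects_nil, Kind.inputs, Kind.outputs] at hm
      omega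
    have hc := connects_append hw (connects_hook hi)
    have h2 := word_append hw (connects_hook hi)
    rw [List.append_assoc] at hc h2
    have h1 := word_circle (u := w) (v := [cap i]) hc
    have h3 : Delta 1 • sandwich n (w ++ [cap i]) = 0 := by
      have e : Delta 1 • word (n + 1 + (n + 1)) (n + 1 + (n + 1)) (w ++ [cap i]) =
          word _ _ (w ++ [cap i]) ⊙ hookElement _ i := h1.symm.trans h2
      rw [sandwich, ← smul_comp, ← comp_smul, e, comp_assoc, comp_assoc,
        ← mul_eq_comp (hookElement _ i), hookElement_mul_boxes hi h, comp_zero, comp_zero]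
    exact (smul_eq_zero.1 h3).resolve_left (Delta_ne_zero 1)
  · rw [sandwich, word, dif_neg hw, comp_zero, zero_comp]

theorem sandwich_cross {n i : ℕ} {s : Bool} {u v : List Piece}
    (h : Connects (u ++ cross s i :: v) (n + 1 + (n + 1)) (n + 1 + (n + 1))) :
    sandwich n (u ++ cross s i :: v) = smoothCoeff s • sandwich n (u ++ cup i :: cap i :: v) +
      (smoothCoeff s)⁻¹ • sandwich n (u ++ v) := by
  simp only [sandwich, word_cross h, comp_add, add_comp, comp_smul, smul_comp]

/-- A crossing directly below an upper idempotent can be replaced by two vertical strands. -/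
theorem sandwich_cross_top {n i : ℕ} {s : Bool} {v : List Piece} (hi : i ≠ n)
    (h : Connects (cross s i :: v) (n + 1 + (n + 1)) (n + 1 + (n + 1))) :
    sandwich n (cross s i :: v) = (smoothCoeff s)⁻¹ • sandwich n v := by
  have := sandwich_cross (u := []) h
  simpa [sandwich_cup hi] using this

theorem sandwich_row_top {n c m : ℕ} {s : Bool} {v : List Piece} (hc : n < c)
    (h : Connects (row s c m ++ v) (n + 1 + (n + 1)) (n + 1 + (n + 1))) :
    Connects v (n + 1 + (n + 1)) (n + 1 + (n + 1)) ∧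
      sandwich n (row s c m ++ v) = (smoothCoeff s)⁻¹ ^ m • sandwich n v := by
  induction m generalizing c with
  | zero => exact ⟨h, by simp [row_zero]⟩
  | succ m ih =>
    rw [row_succ_left, List.cons_append] at h ⊢
    have h' := (connects_smooth (u := []) h).2
    obtain ⟨h1, h2⟩ := ih (by omega) h'
    refine ⟨h1, ?_⟩
    rw [sandwich_cross_top (by omega) h, h2, smul_smul, pow_succ']

/-- In `j` of the `n` remaining rows the first crossing is already removed, which leaves a block of
`j` rows of length `n`; the other `k` are still to be treated. -/
theorem sandwich_rows_top {n k j : ℕ} {s : Bool} (hn : j + k = n)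
    (h : Connects (rows s (k + 1) j n ++ rows s 0 k (n + 1))
      (n + 1 + (n + 1)) (n + 1 + (n + 1))) :
    sandwich n (rows s (k + 1) j n ++ rows s 0 k (n + 1)) =
      (smoothCoeff s)⁻¹ ^ k • sandwich n (rows s 1 n n) := by
  induction k generalizing j with
  | zero => obtain rfl : j = n := hn; simp [rows]
  | succ k ih =>
    -- The first crossing of the next row lies to the left of the whole block, so it rises to the
    -- upper left idempotent; the rest of that row joins the block.
    have h1 : Isotopic (rows s (k + 1 + 1) j n ++ rows s 0 (k + 1) (n + 1))
        (cross s k :: (rows s (k + 1) (j + 1) n ++ rows s 0 k (n + 1))) := by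
      rw [rows_succ_bottom s (k + 1), rows_succ, row_succ_left, Nat.zero_add]
      simpa using (rows_cross_comm s (i := k) (c := k + 1 + 1) (k := j) (m := n)
        (by omega)).append_right (row s (k + 1) n ++ rows s 0 k (n + 1))
    have h2 := (h1 _ _ h).1
    rw [h1.sandwich_eq h, sandwich_cross_top (by omega) h2,
      ih (by omega) (connects_smooth (u := []) h2).2, smul_smul, pow_succ']

/-- The `∩` travels right along the first row from `c` to `n + n`, with one factor for each
straightened zigzag. -/
theorem sandwich_cap_row {n c m : ℕ} {s : Bool} (u : List Piece) (hc : n ≤ c) (hm : c + m = n + n)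
    (h : Connects (u ++ cap c :: (row s (c + 1) m ++ rows s 0 n (n + 1)))
      (n + 1 + (n + 1)) (n + 1 + (n + 1))) :
    Connects (u ++ cap (n + n) :: rows s 0 n (n + 1)) (n + 1 + (n + 1)) (n + 1 + (n + 1)) ∧
    sandwich n (u ++ cap c :: (row s (c + 1) m ++ rows s 0 n (n + 1))) =
      smoothCoeff s ^ m • sandwich n (u ++ cap (n + n) :: rows s 0 n (n + 1)) := by
  induction m generalizing c with
  | zero =>
    obtain rfl : c = n + n := hm
    exact ⟨h, by simp [row_zero]⟩
  | succ m ih =>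
    have e : u ++ cap c :: (row s (c + 1) (m + 1) ++ rows s 0 n (n + 1)) =
        (u ++ [cap c]) ++ cross s (c + 1) :: (row s (c + 2) m ++ rows s 0 n (n + 1)) := by
      simp [row_succ_left]
    rw [e] at h ⊢
    obtain ⟨h1, h2⟩ := connects_smooth h
    have i1 : Isotopic
        ((u ++ [cap c]) ++ cup (c + 1) :: cap (c + 1) :: (row s (c + 2) m ++ rows s 0 n (n + 1)))
        (u ++ cap (c + 1) :: (row s (c + 1 + 1) m ++ rows s 0 n (n + 1))) := by
      simpa using ((LocalMove.zigzag_left c).isotopic.append_right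
        (cap (c + 1) :: (row s (c + 2) m ++ rows s 0 n (n + 1)))).append_left u
    obtain ⟨p, rfl⟩ := Nat.exists_eq_add_of_le' hc
    obtain ⟨q, hq⟩ := Nat.exists_eq_add_of_le (show p + 1 ≤ n by omega)
    -- In the other smoothing the `n` lower strands are pulled off the `∩`, which arrives at `p < n`
    -- and dies at the lower left idempotent.
    have i2 : Isotopic ((u ++ [cap (p + n)]) ++ (row s (p + n + 2) m ++ rows s 0 n (n + 1)))
        ((u ++ row s (p + n) m ++ rows s 0 n (p + q)) ++ [cap p]) := by
      have j1 := ((cap_row_right s (i := p + n) m le_rfl).append_right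
        (rows s 0 n (n + 1))).append_left u
      have j2 := (cap_rows_across s n 0 p q).append_left (u ++ row s (p + n) m)
      rw [Nat.zero_add, show p + 2 + q = n + 1 by omega] at j2
      simp only [List.append_assoc, List.cons_append, List.nil_append] at j1 j2 ⊢
      exact j1.trans j2
    obtain ⟨h3, h4⟩ := ih (by omega) (by omega) (i1 _ _ h1).1
    refine ⟨h3, ?_⟩
    rw [sandwich_cross h, i1.sandwich_eq h1, i2.sandwich_eq h2, sandwich_cap (by omega), h4,
      smul_zero, add_zero, smul_smul, pow_succ']

/-- The `∩` returns from `n + k` to the middle; it meets only the last crossing of each row, so each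
row is shortened from `n + 1` to `n`. -/
theorem sandwich_cap_rows {n k : ℕ} {s : Bool} (u : List Piece) (hk : k ≤ n)
    (h : Connects (u ++ cap (n + k) :: rows s 0 k (n + 1)) (n + 1 + (n + 1)) (n + 1 + (n + 1))) :
    sandwich n (u ++ cap (n + k) :: rows s 0 k (n + 1)) =
      smoothCoeff s ^ k • sandwich n (u ++ rows s 0 k n ++ [cap n]) := by
  induction k generalizing u with
  | zero => simp [rows]
  | succ k ih =>
    have i0 : Isotopic (u ++ cap (n + (k + 1)) :: rows s 0 (k + 1) (n + 1))
        ((u ++ row s k n ++ [cap (n + k + 1)]) ++ cross s (n + k) :: rows s 0 k (n + 1)) := by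
      have := ((cap_row_comm s (i := n + k + 1) (c := k) (m := n) (by omega)).append_left
        u).append_right (cross s (n + k) :: rows s 0 k (n + 1))
      rw [rows_succ, row_succ, Nat.zero_add, Nat.add_comm k n]
      simpa [Nat.add_assoc] using this
    have h0 := (i0 _ _ h).1
    obtain ⟨h1, h2⟩ := connects_smooth h0
    have i1 : Isotopic ((u ++ row s k n ++ [cap (n + k + 1)]) ++
          cup (n + k) :: cap (n + k) :: rows s 0 k (n + 1))
        (u ++ row s k n ++ cap (n + k) :: rows s 0 k (n + 1)) := by
      simpa using ((LocalMove.zigzag_right (n + k)).isotopic.append_right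
        (cap (n + k) :: rows s 0 k (n + 1))).append_left (u ++ row s k n)
    -- In the other smoothing the `∩` lies to the right of everything below it and falls onto the
    -- lower right idempotent.
    have i2 : Isotopic ((u ++ row s k n ++ [cap (n + k + 1)]) ++ rows s 0 k (n + 1))
        ((u ++ row s k n ++ rows s 0 k (n + 1)) ++ [cap (n + k + 1)]) := by
      simpa using (cap_rows_comm s (i := n + k + 1) (c := 0) (k := k) (m := n + 1)
        (by omega)).append_left (u ++ row s k n)
    rw [i0.sandwich_eq h, sandwich_cross h0, i1.sandwich_eq h1, i2.sandwich_eq h2,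
      sandwich_cap (by omega), ih _ (by omega) (i1 _ _ h1).1, smul_zero, add_zero, smul_smul,
      pow_succ', rows_succ, Nat.zero_add, List.append_assoc u]

/-- The skein relation for the crossing of two colored strands. -/
theorem withFourBoxes_bundleCrossing (s : Bool) (n : ℕ) :
    withFourBoxes (bundleCrossing s (n + 1)) =
      smoothCoeff s ^ (2 * n + 1) • horizontalSmoothing s n +
        (smoothCoeff s)⁻¹ ^ (2 * n + 1) • verticalSmoothing s n := by
  have hC := connects_crossWord s (n + 1)
  -- Singles out the crossing of the two innermost strands, the only one at the top that both
  -- idempotents touch.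
  have e : crossWord s (n + 1) = cross s n :: (row s (n + 1) n ++ rows s 0 n (n + 1)) := by
    rw [crossWord_eq_rows, rows_succ, Nat.zero_add, row_succ_left]; rfl
  have hH : horizontalSmoothing s n = sandwich n ([cup n] ++ rows s 0 n n ++ [cap n]) := by
    rw [horizontalSmoothing, withFourBoxes_eq_sandwich, ← crossWord_eq_rows]; rfl
  have hV : verticalSmoothing s n = sandwich n (rows s 1 n n) := by
    rw [verticalSmoothing, withFourBoxes_eq_sandwich]
    simp only [verticalDiagram, crossWord_eq_rows, map_shift_rows]
  have hX : withFourBoxes (bundleCrossing s (n + 1)) = sandwich n (crossWord s (n + 1)) :=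
    withFourBoxes_eq_sandwich _
  rw [e] at hC
  obtain ⟨h1, h2⟩ := connects_smooth (u := []) hC
  obtain ⟨h3, e3⟩ := sandwich_cap_row [cup n] le_rfl rfl h1
  obtain ⟨h4, e4⟩ := sandwich_row_top (Nat.lt_succ_self n) h2
  have e5 := sandwich_rows_top (j := 0) (k := n) (Nat.zero_add n) h4
  rw [rows, List.nil_append] at e5
  have e6 := sandwich_cross (u := []) hC
  simp only [List.nil_append, List.cons_append] at e3 e4 e6
  have e7 := sandwich_cap_rows [cup n] le_rfl h3
  simp only [List.cons_append, List.nil_append] at e7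
  rw [hX, hH, hV, e, e6, e3, e4, e5, e7]
  simp only [smul_smul, List.cons_append, List.nil_append]
  congr 2 <;> ring

theorem smoothing_zero (s : Bool) :
    coloredCrossing s 1 = (simpleCrossing s).toSkein ∧
      horizontalSmoothing s 0 = (hook 0).toSkein ∧
      verticalSmoothing s 0 = (Diagram.id 2).toSkein := by
  have hb : boxes 1 = (1 : Skein 2 2) := by
    rw [boxes_eq]; exact mul_one _
  have h4 : ∀ d : Diagram 2 2, withFourBoxes (n := 1) d = d.toSkein := fun d => by
    rw [withFourBoxes, hb]
    exact (comp_id _).trans (id_comp _)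
  refine ⟨?_, ?_, ?_⟩
  · rw [coloredCrossing_eq_withFourBoxes]; exact h4 _
  · exact h4 _
  · exact h4 _

end

end KauffmanSkein

theorem mainTheorem4 (n : ℕ) :
    -- the crossing whose strand from the upper left to the lower right is on top
    (coloredCrossing true (n + 1) =
        A ^ (2 * (n : ℤ) + 1) • horizontalSmoothing true n +
          A ^ (-(2 * (n : ℤ) + 1)) • verticalSmoothing true n ∧
      withFourBoxes (bundleCrossing true (n + 1)) =
        A ^ (2 * (n : ℤ) + 1) • horizontalSmoothing true n +
          A ^ (-(2 * (n : ℤ) + 1)) • verticalSmoothing true n) ∧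
    -- the other crossing
    (coloredCrossing false (n + 1) =
        A ^ (2 * (n : ℤ) + 1) • verticalSmoothing false n +
          A ^ (-(2 * (n : ℤ) + 1)) • horizontalSmoothing false n ∧
      withFourBoxes (bundleCrossing false (n + 1)) =
        A ^ (2 * (n : ℤ) + 1) • verticalSmoothing false n +
          A ^ (-(2 * (n : ℤ) + 1)) • horizontalSmoothing false n) ∧
    -- for `n = 0` the terms are the terms of the Kauffman skein relation
    (∀ s : Bool,
      coloredCrossing s 1 = (simpleCrossing s).toSkein ∧
      horizontalSmoothing s 0 = (hook 0).toSkein ∧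
      verticalSmoothing s 0 = (Diagram.id 2).toSkein) := by
  have hz : (2 * (n : ℤ) + 1) = ((2 * n + 1 : ℕ) : ℤ) := by push_cast; rfl
  have ht := withFourBoxes_bundleCrossing true n
  have hf := withFourBoxes_bundleCrossing false n
  simp only [smoothCoeff, if_true, Bool.false_eq_true, if_false, inv_inv] at ht hf
  -- For this crossing the coefficient of `∪` above `∩` is `A⁻¹`, so the two smoothings trade
  -- places.
  replace hf := hf.trans (add_comm _ _)
  rw [hz, zpow_neg, zpow_natCast, ← inv_pow, coloredCrossing_eq_withFourBoxes,
    coloredCrossing_eq_withFourBoxes]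
  exact ⟨⟨ht, ht⟩, ⟨hf, hf⟩, smoothing_zero⟩
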